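/- Conventions. Rings are associative with unit, modules are left modules, and artinian means left artinian. Let $A=\bigoplus_{i\ge 0}A_i$ be an $\mathbb N$-graded ring which is left finite (every $A_i$ is a finitely generated left $A_0$-module) and generated in degree $1$ ($A_iA_j=A_{i+j}$ for all $i,j\ge 0$), with $A_0$ artinian. Let $J=J(A_0)\oplus A_{\ge 1}$ be its graded Jacobson radical, where $J(A_0)$ is the Jacobson radical of $A_0$. Graded $A$-modules are $\mathbb Z$-graded. A graded module $M$ is left finite if every $M_i$ is a finitely generated $A_0$-module, and bounded below if $M_i=0$ for all $i\ll 0$. A graded projective resolution $\cdots\to P_n\xrightarrow{d_n}P_{n-1}\to\cdots\to P_0\xrightarrow{d_0}M\to 0$ is minimal if $\operatorname{im} d_{n+1}\subseteq JP_n$ for all $n\ge 0$. The graded module $M$ is called Koszul if it has a minimal graded projective resolution such that $J^k\operatorname{Ker}d_n=\operatorname{Ker}d_n\cap J^{k+1}P_n$ for all $n,k\ge 0$; the ring $A$ is called Koszul if the graded $A$-module $A/J$ is Koszul. If $B$ is an $\mathbb N$-graded ring with $B_0$ artinian semisimple, a graded $B$-module $N$ generated in degree $0$ is called classically Koszul if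 it has a graded projective resolution $\cdots\to Q_1\to Q_0\to N\to 0$ in which every $Q_n$ is generated in degree $n$; the ring $B$ is called classically Koszul if $B_0=B/B_{\ge 1}$ is a classically Koszul $B$-module. Let $\operatorname{Gr}_JA=\bigoplus_{n\ge 0}J^n/J^{n+1}$ and, for a graded $A$-module $M$, let $\operatorname{Gr}_JM=\bigoplus_{n\ge 0}J^nM/J^{n+1}M$, a graded $\operatorname{Gr}_JA$-module, both graded by the index $n$ of the $J$-adic filtration. Theorem. Under these assumptions on $A$: (1) If $M$ is a left finite, bounded below graded $A$-module such that $\operatorname{Gr}_JM$ is a classically Koszul $\operatorname{Gr}_JA$-module, then $M$ is a Koszul $A$-module. (2) If $\operatorname{Gr}_JA$ is a classically Koszul ring, then $A$ is a Koszul ring. -/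

import Mathlib

universe u v

open scoped DirectSum

noncomputable section

namespace GradedKoszul

/-! ### Graded rings and graded modules

Rings are associative and unital, not necessarily commutative; modules are left modules, and `Ideal`
means left ideal. Rings are graded by `ℕ`, modules by `ℤ`. -/

section Basic

variable {A : Type u} [Ring A] {M : Type v} [AddCommGroup M] [Module A M]

/-- `ℳ` is a grading of the `A`-module `M`: `M = ⨁ j, ℳ j` and `A_i M_j ⊆ M_(i+j)`. -/
structure IsGradedModule (𝒜 : ℕ → AddSubgroup A) (ℳ : ℤ → AddSubgroup M) : Prop where
  isInternal : DirectSum.IsInternal ℳ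
  smul_mem : ∀ (i : ℕ) (j : ℤ), ∀ a ∈ 𝒜 i, ∀ m ∈ ℳ j, a • m ∈ ℳ ((i : ℤ) + j)

/-- The `ℤ`-grading obtained from an `ℕ`-indexed family by putting `0` in negative degrees. -/
def extendByZero (ℳ : ℕ → AddSubgroup M) : ℤ → AddSubgroup M
  | Int.ofNat n => ℳ n
  | Int.negSucc _ => ⊥

/-- `A` is generated in degree `1`: `A_i A_j = A_(i+j)` for all `i, j ≥ 0`. -/
def IsGeneratedInDegreeOne (𝒜 : ℕ → AddSubgroup A) : Prop :=
  ∀ i j : ℕ, AddSubgroup.closure {x | ∃ a ∈ 𝒜 i, ∃ b ∈ 𝒜 j, x = a * b} = 𝒜 (i + j)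

/-- A family of homogeneous components (of `A` itself or of an `A`-module) is left finite: each of
them is a finitely generated left `A_0`-module. -/
def IsLeftFinite {ι : Type*} (𝒜 : ℕ → AddSubgroup A) [GradedRing 𝒜] (ℳ : ι → AddSubgroup M) :
    Prop :=
  ∀ i, ∃ s : Finset M,
    (Submodule.span (SetLike.GradeZero.subring 𝒜) (s : Set M)).toAddSubgroup = ℳ i

/-- `M_j = 0` for all sufficiently negative `j`. -/
def IsBoundedBelow (ℳ : ℤ → AddSubgroup M) : Prop :=
  ∃ l : ℤ, ∀ j < l, ℳ j = ⊥

variable (A) in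
/-- `M` is generated, as an `A`-module, by its component of degree `i`. -/
def IsGeneratedInDegree (ℳ : ℤ → AddSubgroup M) (i : ℤ) : Prop :=
  Submodule.span A (ℳ i : Set M) = ⊤

/-- The graded Jacobson radical `J = J(A_0) ⊕ A_{≥1}`: the elements of `A` whose component of degree
`0` lies in the Jacobson radical of `A_0`. -/
abbrev gradedJacobson (𝒜 : ℕ → AddSubgroup A) [GradedRing 𝒜] : Ideal A :=
  (Ring.jacobson (𝒜 0)).comap (GradedRing.projZeroRingHom' 𝒜)

/-- The ideal `A_{≥1}`: the elements of `A` whose component of degree `0` vanishes. -/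
abbrev positivePart (𝒜 : ℕ → AddSubgroup A) [GradedRing 𝒜] : Ideal A :=
  RingHom.ker (GradedRing.projZeroRingHom' 𝒜)

/-- The grading of the left `A`-module `A ⧸ I` by the images of the components of `A`. -/
def quotientGrading (𝒜 : ℕ → AddSubgroup A) (I : Ideal A) : ℤ → AddSubgroup (A ⧸ I) :=
  extendByZero fun n => (𝒜 n).map (Submodule.mkQ I).toAddMonoidHom

end Basic

/-! ### Graded projective resolutions -/

section Resolution

variable {A : Type u} [Ring A] {M : Type v} [AddCommGroup M] [Module A M]

/-- A graded projective resolution `⋯ → P 1 → P 0 → M → 0`: an exact complex of graded modules and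
homomorphisms of degree `0`, each `P n` being projective. (A graded module is projective in the
category of graded modules if and only if it is projective as a module.) -/
structure GradedProjectiveResolution (𝒜 : ℕ → AddSubgroup A) (ℳ : ℤ → AddSubgroup M) where
  P : ℕ → Type (max u v)
  [addCommGroup : ∀ n, AddCommGroup (P n)]
  [module : ∀ n, Module A (P n)]
  grading : ∀ n, ℤ → AddSubgroup (P n)
  isGraded : ∀ n, IsGradedModule 𝒜 (grading n)
  projective : ∀ n, Module.Projective A (P n)
  /-- the augmentation `P 0 → M` -/
  ε : P 0 →ₗ[A] M
  /-- the differential `P (n + 1) → P n` -/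
  d : ∀ n, P (n + 1) →ₗ[A] P n
  ε_mem : ∀ j, ∀ x ∈ grading 0 j, ε x ∈ ℳ j
  d_mem : ∀ n j, ∀ x ∈ grading (n + 1) j, d n x ∈ grading n j
  ε_surjective : Function.Surjective ε
  exact_zero : Function.Exact (d 0) ε
  exact_succ : ∀ n, Function.Exact (d (n + 1)) (d n)

namespace GradedProjectiveResolution

attribute [instance] addCommGroup module

variable {𝒜 : ℕ → AddSubgroup A} {ℳ : ℤ → AddSubgroup M}

/-- The kernel of the homomorphism that starts in `P n`, that is, of `P 0 → M` for `n = 0` and of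
`P n → P (n - 1)` for `n > 0`. -/
def ker (R : GradedProjectiveResolution 𝒜 ℳ) : ∀ n, Submodule A (R.P n)
  | 0 => LinearMap.ker R.ε
  | n + 1 => LinearMap.ker (R.d n)

/-- The resolution is minimal: the image of `P (n + 1)` lies in `J P n` for all `n`. -/
def IsMinimal [GradedRing 𝒜] (R : GradedProjectiveResolution 𝒜 ℳ) : Prop :=
  ∀ n, LinearMap.range (R.d n) ≤ gradedJacobson 𝒜 • (⊤ : Submodule A (R.P n))

/-- The resolution is linear: `P n` is generated in degree `n` for all `n`. -/
def IsLinear (R : GradedProjectiveResolution 𝒜 ℳ) : Prop :=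
  ∀ n : ℕ, IsGeneratedInDegree A (R.grading n) (n : ℤ)

end GradedProjectiveResolution

end Resolution

/-! ### Koszul and classically Koszul modules and rings -/

section Koszul

variable {A : Type u} [Ring A] {M : Type v} [AddCommGroup M] [Module A M]

/-- `M` is a Koszul `A`-module: it has a minimal graded projective resolution such that
`J^k Ker d_n = Ker d_n ∩ J^(k+1) P_n` for all `n, k ≥ 0`. -/
def IsKoszul (𝒜 : ℕ → AddSubgroup A) [GradedRing 𝒜] (ℳ : ℤ → AddSubgroup M) : Prop :=
  ∃ R : GradedProjectiveResolution 𝒜 ℳ, R.IsMinimal ∧ ∀ n k : ℕ,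
    gradedJacobson 𝒜 ^ k • R.ker n =
      R.ker n ⊓ gradedJacobson 𝒜 ^ (k + 1) • (⊤ : Submodule A (R.P n))

/-- `A` is a Koszul ring: the graded `A`-module `A / J` is Koszul. -/
def IsKoszulRing (𝒜 : ℕ → AddSubgroup A) [GradedRing 𝒜] : Prop :=
  IsKoszul 𝒜 (quotientGrading 𝒜 (gradedJacobson 𝒜))

/-- `M` is a classically Koszul `A`-module: `A_0` is (artinian) semisimple, `M` is generated in
degree `0`, and `M` has a linear projective resolution. -/
def IsClassicallyKoszul (𝒜 : ℕ → AddSubgroup A) [GradedRing 𝒜] (ℳ : ℤ → AddSubgroup M) : Prop :=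
  IsSemisimpleRing (𝒜 0) ∧ IsGeneratedInDegree A ℳ 0 ∧
    ∃ R : GradedProjectiveResolution 𝒜 ℳ, R.IsLinear

/-- `A` is a classically Koszul ring: the graded `A`-module `A_0 = A / A_{≥1}` is classically
Koszul. -/
def IsClassicallyKoszulRing (𝒜 : ℕ → AddSubgroup A) [GradedRing 𝒜] : Prop :=
  IsClassicallyKoszul 𝒜 (quotientGrading 𝒜 (positivePart 𝒜))

end Koszul

/-! ### Associated graded rings and modules -/

section AssociatedGraded

variable {A : Type u} [Ring A] {M : Type v} [AddCommGroup M] [Module A M]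

/-- The `n`-th piece `F n / (F n ∩ F (n + 1))` of the associated graded module of a filtration; for a
decreasing filtration this is `F n / F (n + 1)`. -/
def GrPiece (F : ℕ → Submodule A M) (n : ℕ) : Type v :=
  ↥(F n) ⧸ (F (n + 1)).comap (F n).subtype

instance (F : ℕ → Submodule A M) (n : ℕ) : AddCommGroup (GrPiece F n) :=
  Submodule.Quotient.addCommGroup ((F (n + 1)).comap (F n).subtype)

/-- The class in `F n / F (n + 1)` of an element of `F n`. -/
def GrPiece.mk (F : ℕ → Submodule A M) (n : ℕ) : ↥(F n) →+ GrPiece F n :=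
  (Submodule.mkQ ((F (n + 1)).comap (F n).subtype)).toAddMonoidHom

theorem GrPiece.mk_surjective (F : ℕ → Submodule A M) (n : ℕ) :
    Function.Surjective (GrPiece.mk F n) :=
  Submodule.mkQ_surjective _

/-- The `I`-adic filtration of the ring `A`. -/
def adicRing (I : Ideal A) : ℕ → Submodule A A := fun n => I ^ n

variable (M) in
/-- The `I`-adic filtration of the module `M`. -/
def adicModule (I : Ideal A) : ℕ → Submodule A M := fun n => I ^ n • (⊤ : Submodule A M)

theorem adicRing_smul_mem (I : Ideal A) [I.IsTwoSided] (i j : ℕ) (a b : A)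
    (ha : a ∈ adicRing I i) (hb : b ∈ adicRing I j) : a • b ∈ adicRing I (i + j) := by
  have h := Ideal.mul_mem_mul (I := I ^ i) (J := I ^ j) ha hb
  rwa [← Ideal.IsTwoSided.pow_add] at h

theorem adicModule_smul_mem (I : Ideal A) [I.IsTwoSided] (i j : ℕ) (a : A) (m : M)
    (ha : a ∈ adicRing I i) (hm : m ∈ adicModule M I j) : a • m ∈ adicModule M I (i + j) := by
  have h := Submodule.smul_mem_smul (I := I ^ i) (N := I ^ j • (⊤ : Submodule A M)) ha hm
  rw [← Submodule.smul_assoc] at h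
  have e : I ^ i • I ^ j = I ^ (i + j) := (Ideal.IsTwoSided.pow_add (I := I) i j).symm
  rwa [e] at h

/-- The multiplication `F i / F (i + 1) × G j / G (j + 1) → G (i + j) / G (i + j + 1)` induced by the
action of `A` on `M`, for filtrations with `F i • G j ⊆ G (i + j)`. -/
def grSMul {F : ℕ → Submodule A A} {G : ℕ → Submodule A M}
    (h : ∀ i j a m, a ∈ F i → m ∈ G j → a • m ∈ G (i + j)) {i j : ℕ} :
    GrPiece F i → GrPiece G j → GrPiece G (i + j) :=
  Quotient.map₂ (fun a m => ⟨a.1 • m.1, h i j a.1 m.1 a.2 m.2⟩) (by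
    intro a a' haa m m' hmm
    have haa' : a.1 - a'.1 ∈ F (i + 1) := (Submodule.quotientRel_def ((F (i + 1)).comap (F i).subtype)).1 haa
    have hmm' : m.1 - m'.1 ∈ G (j + 1) := (Submodule.quotientRel_def ((G (j + 1)).comap (G j).subtype)).1 hmm
    refine (Submodule.quotientRel_def _).2 ?_
    change a.1 • m.1 - a'.1 • m'.1 ∈ G (i + j + 1)
    have h1 : (a.1 - a'.1) • m.1 ∈ G (i + j + 1) := by
      have := h (i + 1) j _ _ haa' m.2
      rwa [show i + 1 + j = i + j + 1 by omega] at this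
    have h2 : a'.1 • (m.1 - m'.1) ∈ G (i + j + 1) := h i (j + 1) _ _ a'.2 hmm'
    have := add_mem h1 h2
    rwa [sub_smul, smul_sub, sub_add_sub_cancel] at this)

section grSMul

variable {F : ℕ → Submodule A A} {G : ℕ → Submodule A M}
  (h : ∀ i j a m, a ∈ F i → m ∈ G j → a • m ∈ G (i + j)) {i j : ℕ}

theorem grSMul_mk (a : F i) (m : G j) :
    grSMul h (GrPiece.mk F i a) (GrPiece.mk G j m) =
      GrPiece.mk G (i + j) ⟨a.1 • m.1, h i j a.1 m.1 a.2 m.2⟩ := rfl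

theorem grSMul_zero (x : GrPiece F i) : grSMul h x (0 : GrPiece G j) = 0 := by
  obtain ⟨a, rfl⟩ := GrPiece.mk_surjective _ _ x
  rw [← map_zero (GrPiece.mk G j), grSMul_mk, ← map_zero (GrPiece.mk G (i + j))]
  congr 1
  exact Subtype.ext (smul_zero _)

theorem zero_grSMul (y : GrPiece G j) : grSMul h (0 : GrPiece F i) y = 0 := by
  obtain ⟨m, rfl⟩ := GrPiece.mk_surjective _ _ y
  rw [← map_zero (GrPiece.mk F i), grSMul_mk, ← map_zero (GrPiece.mk G (i + j))]
  congr 1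
  exact Subtype.ext (zero_smul _ _)

theorem grSMul_add (x : GrPiece F i) (y z : GrPiece G j) :
    grSMul h x (y + z) = grSMul h x y + grSMul h x z := by
  obtain ⟨a, rfl⟩ := GrPiece.mk_surjective _ _ x
  obtain ⟨m, rfl⟩ := GrPiece.mk_surjective _ _ y
  obtain ⟨n, rfl⟩ := GrPiece.mk_surjective _ _ z
  rw [← map_add, grSMul_mk, grSMul_mk, grSMul_mk, ← map_add]
  congr 1
  exact Subtype.ext (smul_add _ _ _)

theorem add_grSMul (x y : GrPiece F i) (z : GrPiece G j) :
    grSMul h (x + y) z = grSMul h x z + grSMul h y z := by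
  obtain ⟨a, rfl⟩ := GrPiece.mk_surjective _ _ x
  obtain ⟨b, rfl⟩ := GrPiece.mk_surjective _ _ y
  obtain ⟨m, rfl⟩ := GrPiece.mk_surjective _ _ z
  rw [← map_add, grSMul_mk, grSMul_mk, grSMul_mk, ← map_add]
  congr 1
  exact Subtype.ext (add_smul _ _ _)

end grSMul

theorem GrPiece.mk_congr (G : ℕ → Submodule A M) {i j : ℕ} (hij : i = j) (x : G i) (y : G j)
    (hxy : x.1 = y.1) :
    GradedMonoid.mk (A := GrPiece G) i (GrPiece.mk G i x) =
      GradedMonoid.mk j (GrPiece.mk G j y) := by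
  subst hij
  obtain rfl : x = y := Subtype.ext hxy
  rfl

theorem one_mem_adicRing (I : Ideal A) : (1 : A) ∈ adicRing I 0 := by
  change (1 : A) ∈ I ^ 0
  rw [Submodule.pow_zero, Ideal.one_eq_top]
  trivial

instance grRingGMul (I : Ideal A) [I.IsTwoSided] : GradedMonoid.GMul (GrPiece (adicRing I)) where
  mul := grSMul (adicRing_smul_mem I)

instance grRingGOne (I : Ideal A) : GradedMonoid.GOne (GrPiece (adicRing I)) where
  one := GrPiece.mk _ 0 ⟨1, one_mem_adicRing I⟩

/-- The pieces `I^n / I^(n+1)` form a graded ring with the multiplication induced by that of `A`. -/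
instance grRingGRing (I : Ideal A) [I.IsTwoSided] : DirectSum.GRing (GrPiece (adicRing I)) where
  mul_zero := grSMul_zero _
  zero_mul := zero_grSMul _
  mul_add := grSMul_add _
  add_mul := add_grSMul _
  one_mul := by
    rintro ⟨i, x⟩
    obtain ⟨a, rfl⟩ := GrPiece.mk_surjective _ _ x
    exact GrPiece.mk_congr _ (zero_add i) _ a (one_mul _)
  mul_one := by
    rintro ⟨i, x⟩
    obtain ⟨a, rfl⟩ := GrPiece.mk_surjective _ _ x
    exact GrPiece.mk_congr _ (add_zero i) _ a (mul_one _)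
  mul_assoc := by
    rintro ⟨i, x⟩ ⟨j, y⟩ ⟨k, z⟩
    obtain ⟨a, rfl⟩ := GrPiece.mk_surjective _ _ x
    obtain ⟨b, rfl⟩ := GrPiece.mk_surjective _ _ y
    obtain ⟨c, rfl⟩ := GrPiece.mk_surjective _ _ z
    exact GrPiece.mk_congr _ (add_assoc i j k) _ _ (mul_assoc _ _ _)
  natCast n := n • GrPiece.mk _ 0 ⟨1, one_mem_adicRing I⟩
  natCast_zero := zero_nsmul _
  natCast_succ n := succ_nsmul _ n
  intCast n := n • GrPiece.mk _ 0 ⟨1, one_mem_adicRing I⟩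
  intCast_ofNat n := natCast_zsmul _ n
  intCast_negSucc_ofNat n := negSucc_zsmul _ n

/-- The pieces `I^n M / I^(n+1) M` form a graded module over the graded ring of the
`I^n / I^(n+1)`. -/
instance grModuleGmodule (I : Ideal A) [I.IsTwoSided] :
    DirectSum.Gmodule (GrPiece (adicRing I)) (GrPiece (adicModule M I)) where
  smul := grSMul (adicModule_smul_mem I)
  one_smul := by
    rintro ⟨i, x⟩
    obtain ⟨m, rfl⟩ := GrPiece.mk_surjective _ _ x
    exact GrPiece.mk_congr _ (zero_add i) _ m (one_smul _ _)
  mul_smul := by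
    rintro ⟨i, x⟩ ⟨j, y⟩ ⟨k, z⟩
    obtain ⟨a, rfl⟩ := GrPiece.mk_surjective _ _ x
    obtain ⟨b, rfl⟩ := GrPiece.mk_surjective _ _ y
    obtain ⟨m, rfl⟩ := GrPiece.mk_surjective _ _ z
    exact GrPiece.mk_congr _ (add_assoc i j k) _ _ (mul_smul _ _ _)
  smul_zero := grSMul_zero _
  zero_smul := zero_grSMul _
  smul_add := grSMul_add _
  add_smul := add_grSMul _

/-- The associated graded ring `Gr_I A = ⨁ n, I^n / I^(n+1)`. -/
def Gr (I : Ideal A) : Type u := ⨁ n, GrPiece (adicRing I) n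

instance (I : Ideal A) [I.IsTwoSided] : Ring (Gr I) :=
  inferInstanceAs (Ring (⨁ n, GrPiece (adicRing I) n))

variable (M) in
/-- The associated graded module `Gr_I M = ⨁ n, I^n M / I^(n+1) M`. -/
def GrModule (I : Ideal A) : Type v := ⨁ n, GrPiece (adicModule M I) n

instance (I : Ideal A) : AddCommGroup (GrModule M I) :=
  inferInstanceAs (AddCommGroup (⨁ n, GrPiece (adicModule M I) n))

instance (I : Ideal A) [I.IsTwoSided] : Module (Gr I) (GrModule M I) :=
  inferInstanceAs (Module (⨁ n, GrPiece (adicRing I) n) (⨁ n, GrPiece (adicModule M I) n))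

/-- The inclusion of `I^n / I^(n+1)` into `Gr_I A`. -/
def Gr.of (I : Ideal A) [I.IsTwoSided] (n : ℕ) : GrPiece (adicRing I) n →+ Gr I :=
  DirectSum.of (GrPiece (adicRing I)) n

variable (M) in
/-- The inclusion of `I^n M / I^(n+1) M` into `Gr_I M`. -/
def GrModule.of (I : Ideal A) (n : ℕ) : GrPiece (adicModule M I) n →+ GrModule M I :=
  DirectSum.of (GrPiece (adicModule M I)) n

/-- The grading of `Gr_I A`: the component of degree `n` is `I^n / I^(n+1)`. -/
def grGrading (I : Ideal A) [I.IsTwoSided] : ℕ → AddSubgroup (Gr I) :=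
  fun n => (Gr.of I n).range

variable (M) in
/-- The grading of `Gr_I M`: the component of degree `n ≥ 0` is `I^n M / I^(n+1) M`, and the
components of negative degree are `0`. -/
def grModuleGrading (I : Ideal A) : ℤ → AddSubgroup (GrModule M I) :=
  extendByZero fun n => (GrModule.of M I n).range

theorem Gr.addHom_ext {N : Type*} [AddCommMonoid N] (I : Ideal A) [I.IsTwoSided] {f g : Gr I →+ N}
    (h : ∀ n x, f (Gr.of I n x) = g (Gr.of I n x)) : f = g :=
  DirectSum.addHom_ext h

/-- The decomposition of an element of `Gr_I A` into its components. -/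
def grDecompose (I : Ideal A) [I.IsTwoSided] : Gr I →+ ⨁ n, grGrading I n :=
  DirectSum.toAddMonoid fun n =>
    (DirectSum.of (fun n => grGrading I n) n).comp
      ((Gr.of I n).codRestrict (grGrading I n) fun x => ⟨x, rfl⟩)

theorem grDecompose_of (I : Ideal A) [I.IsTwoSided] (n : ℕ) (x : GrPiece (adicRing I) n) :
    grDecompose I (Gr.of I n x) =
      DirectSum.of (fun n => grGrading I n) n ⟨Gr.of I n x, x, rfl⟩ :=
  DirectSum.toAddMonoid_of (fun n => (DirectSum.of (fun n => grGrading I n) n).comp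
    ((Gr.of I n).codRestrict (grGrading I n) fun x => ⟨x, rfl⟩)) n x

instance grGradedRing (I : Ideal A) [I.IsTwoSided] : GradedRing (grGrading I) where
  one_mem := ⟨GradedMonoid.GOne.one, rfl⟩
  mul_mem := by
    rintro i j _ _ ⟨x, rfl⟩ ⟨y, rfl⟩
    exact ⟨GradedMonoid.GMul.mul x y, (DirectSum.of_mul_of x y).symm⟩
  decompose' := grDecompose I
  left_inv := by
    have h : (DirectSum.coeAddMonoidHom (grGrading I)).comp (grDecompose I) =
        AddMonoidHom.id (Gr I) := by
      refine Gr.addHom_ext I fun n x => ?_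
      rw [AddMonoidHom.comp_apply, grDecompose_of, DirectSum.coeAddMonoidHom_of]
      rfl
    exact DFunLike.congr_fun h
  right_inv := by
    have h : (grDecompose I).comp (DirectSum.coeAddMonoidHom (grGrading I)) =
        AddMonoidHom.id (⨁ n, grGrading I n) := by
      refine DirectSum.addHom_ext fun n x => ?_
      obtain ⟨_, y, rfl⟩ := x
      rw [AddMonoidHom.comp_apply, DirectSum.coeAddMonoidHom_of, grDecompose_of]
      rfl
    exact DFunLike.congr_fun h

end AssociatedGraded

end GradedKoszul

end

universe w

noncomputable section

namespace GradedKoszul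

/-! ### Homogeneous components of graded modules -/

section GradedModules

/-! The minimal resolution of `M` over `A` is built one projective cover at a time, and each cover
is compared with the given linear resolution `R` of `Gr_J M` over `Gr_J A`.

Let `φ : P → M` be a graded projective cover with kernel `K ⊆ JP` (`exists_projectiveCover`). Then
`Gr_J P` is projective and generated in degree 0, and `Gr_J P → Gr_J M` is an isomorphism in degree
0. The same holds for `R.P 0 → Gr_J M`, so the two covers are isomorphic, and `R.P 1` maps onto the
kernel of `Gr_J P → Gr_J M` (`exists_linear_presentation_of_isLinear`). This kernel is therefore
generated in degree 1. In terms of elements: `K ∩ J^(n+1) P ⊆ J^n K + J^(n+2) P`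
(`ker_inf_pow_smul_le_of_isLinear`).

Iteration pushes the error term into arbitrarily high powers of `J`. It disappears because `J(A_0)`
is nilpotent and the modules are bounded below: in a fixed degree a high power of `J` contributes
nothing, so graded submodules are closed in the `J`-adic topology (`mem_of_forall_mem_sup`). This
gives `J^k K = K ∩ J^(k+1) P`, which is the Koszul condition at this step.

The same equality identifies `Gr_J K`, up to a shift by one, with the kernel of `Gr_J P → Gr_J M`.
So `Gr_J K` is linearly resolved by the tail of `R` (`exists_isLinear_ker`), and the construction
repeats with `K` in place of `M`.

Part (2) is the case `M = A/J`, since `Gr_J (A/J)` is the quotient of `Gr_J A` by its positive part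
(`exists_bijective_quotient_positivePart`). -/

theorem isInternal_of_projections {ι : Type*} {M : Type*} [AddCommGroup M] [DecidableEq ι]
    {ℳ : ι → AddSubgroup M} (p : ι → M →+ M) (hself : ∀ j, ∀ m ∈ ℳ j, p j m = m)
    (hne : ∀ i j, i ≠ j → ∀ m ∈ ℳ i, p j m = 0)
    (hgen : ∀ m, m ∈ ⨆ j, ℳ j) : DirectSum.IsInternal ℳ := by
  constructor
  · rw [injective_iff_map_eq_zero]
    intro x hx
    -- Applying `p j` to a sum of homogeneous elements extracts its component of degree `j`; a
    -- vanishing sum thus has vanishing components.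
    have key : ∀ j, (p j).comp (DirectSum.coeAddMonoidHom ℳ) =
        (ℳ j).subtype.comp (DFinsupp.evalAddMonoidHom j) := by
      intro j
      refine DirectSum.addHom_ext fun i y => ?_
      rw [AddMonoidHom.comp_apply, DirectSum.coeAddMonoidHom_of, AddMonoidHom.comp_apply]
      by_cases h : i = j
      · subst h
        rw [hself i _ y.2]
        exact congrArg Subtype.val (DirectSum.of_eq_same (β := fun i => ℳ i) i y).symm
      · rw [hne i j h _ y.2]
        exact congrArg Subtype.val
          (DirectSum.of_eq_of_ne (β := fun i => ℳ i) i j y (Ne.symm h)).symm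
    refine DFinsupp.ext fun j => Subtype.ext ?_
    have := DFunLike.congr_fun (key j) x
    rw [AddMonoidHom.comp_apply, hx, map_zero] at this
    exact this.symm
  · intro m
    have hle : (⨆ j, ℳ j) ≤ (DirectSum.coeAddMonoidHom ℳ).range := by
      refine iSup_le fun j y hy => ⟨DirectSum.of (fun i => ℳ i) j ⟨y, hy⟩, ?_⟩
      exact DirectSum.coeAddMonoidHom_of _ _ _
    exact hle (hgen m)

theorem mem_iSup_of_isInternal {ι : Type*} {M : Type*} [AddCommGroup M] [DecidableEq ι]
    {ℳ : ι → AddSubgroup M} (h : DirectSum.IsInternal ℳ) (m : M) : m ∈ ⨆ j, ℳ j := by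
  obtain ⟨x, rfl⟩ := h.surjective m
  induction x using DirectSum.induction_on with
  | zero => rw [map_zero]; exact zero_mem _
  | of j x =>
    rw [DirectSum.coeAddMonoidHom_of]
    exact AddSubgroup.mem_iSup_of_mem j x.2
  | add x y hx hy => rw [map_add]; exact add_mem hx hy

variable {A : Type*} [Ring A] {𝒜 : ℕ → AddSubgroup A}
  {M : Type*} [AddCommGroup M] [Module A M] {ℳ : ℤ → AddSubgroup M}
  {N : Type*} [AddCommGroup N] [Module A N] {𝒩 : ℤ → AddSubgroup N}

/-- The projection of a graded module to its component of degree `j`. -/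
def gradedProj (h : DirectSum.IsInternal ℳ) (j : ℤ) : M →+ M :=
  (ℳ j).subtype.comp ((DFinsupp.evalAddMonoidHom (β := fun i => ℳ i) j).comp
    (AddEquiv.ofBijective (DirectSum.coeAddMonoidHom ℳ) h).symm.toAddMonoidHom)

namespace IsGradedModule

variable (h : IsGradedModule 𝒜 ℳ)

theorem proj_mem (j : ℤ) (m : M) : gradedProj h.isInternal j m ∈ ℳ j :=
  SetLike.coe_mem _

theorem equiv_symm_of_mem {j : ℤ} {m : M} (hm : m ∈ ℳ j) :
    (AddEquiv.ofBijective (DirectSum.coeAddMonoidHom ℳ) h.isInternal).symm m =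
      DirectSum.of (fun i => ℳ i) j ⟨m, hm⟩ := by
  rw [AddEquiv.symm_apply_eq]
  exact (DirectSum.coeAddMonoidHom_of ℳ j ⟨m, hm⟩).symm

theorem proj_self {j : ℤ} {m : M} (hm : m ∈ ℳ j) : gradedProj h.isInternal j m = m := by
  change Subtype.val (((AddEquiv.ofBijective (DirectSum.coeAddMonoidHom ℳ) h.isInternal).symm m) j)
    = m
  rw [h.equiv_symm_of_mem hm]
  exact congrArg Subtype.val (DirectSum.of_eq_same (β := fun i => ℳ i) j ⟨m, hm⟩)

theorem proj_of_ne {i j : ℤ} (hij : i ≠ j) {m : M} (hm : m ∈ ℳ i) :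
    gradedProj h.isInternal j m = 0 := by
  change Subtype.val (((AddEquiv.ofBijective (DirectSum.coeAddMonoidHom ℳ) h.isInternal).symm m) j)
    = 0
  rw [h.equiv_symm_of_mem hm]
  exact congrArg Subtype.val (DirectSum.of_eq_of_ne (β := fun i => ℳ i) i j ⟨m, hm⟩ hij.symm)

@[elab_as_elim]
theorem induction (h : IsGradedModule 𝒜 ℳ) {motive : M → Prop} (m : M) (mem : ∀ j, ∀ x ∈ ℳ j, motive x)
    (zero : motive 0) (add : ∀ x y, motive x → motive y → motive (x + y)) : motive m := by
  exact AddSubgroup.iSup_induction ℳ (C := motive) (mem_iSup_of_isInternal h.isInternal m)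
    mem zero add

theorem ext_proj {x y : M}
    (hxy : ∀ j, gradedProj h.isInternal j x = gradedProj h.isInternal j y) : x = y := by
  apply (AddEquiv.ofBijective (DirectSum.coeAddMonoidHom ℳ) h.isInternal).symm.injective
  exact DFinsupp.ext fun j => Subtype.ext (hxy j)

theorem mem_of_proj_mem (S : AddSubgroup M) {x : M}
    (hx : ∀ j, gradedProj h.isInternal j x ∈ S) : x ∈ S := by
  classical
  set e := AddEquiv.ofBijective (DirectSum.coeAddMonoidHom ℳ) h.isInternal
  have h1 : x = DirectSum.coeAddMonoidHom ℳ (e.symm x) := (e.apply_symm_apply x).symm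
  rw [h1, DirectSum.coeAddMonoidHom_eq_dfinsuppSum]
  exact dfinsuppSum_mem S _ _ fun j _ => hx j

theorem mem_iff_proj_eq {j : ℤ} {x : M} :
    x ∈ ℳ j ↔ ∀ i, i ≠ j → gradedProj h.isInternal i x = 0 := by
  refine ⟨fun hx i hi => h.proj_of_ne hi.symm hx, fun hx => ?_⟩
  have : x = gradedProj h.isInternal j x := by
    refine h.ext_proj fun i => ?_
    by_cases hi : i = j
    · subst hi
      rw [h.proj_self (h.proj_mem i x)]
    · rw [hx i hi, h.proj_of_ne (Ne.symm hi) (h.proj_mem j x)]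
  rw [this]
  exact h.proj_mem j x

theorem proj_smul {i : ℕ} {a : A} (ha : a ∈ 𝒜 i) (j : ℤ) (m : M) :
    gradedProj h.isInternal (i + j) (a • m) = a • gradedProj h.isInternal j m := by
  induction m using h.induction with
  | mem k x hx =>
    by_cases hk : k = j
    · subst hk
      rw [h.proj_self hx, h.proj_self (h.smul_mem i k a ha x hx)]
    · rw [h.proj_of_ne hk hx, smul_zero]
      exact h.proj_of_ne (by omega) (h.smul_mem i k a ha x hx)
  | zero => simp
  | add x y hx hy => rw [smul_add, map_add, hx, hy, map_add, smul_add]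

theorem proj_smul' {i : ℕ} {a : A} (ha : a ∈ 𝒜 i) (j : ℤ) (m : M) :
    gradedProj h.isInternal j (a • m) = a • gradedProj h.isInternal (j - i) m := by
  rw [← h.proj_smul ha]
  congr 2
  omega

/-- A homomorphism of degree `s` commutes with the projections. -/
theorem map_proj (h : IsGradedModule 𝒜 ℳ) (h' : IsGradedModule 𝒜 𝒩) {s : ℤ} (f : M →+ N)
    (hf : ∀ j, ∀ x ∈ ℳ j, f x ∈ 𝒩 (j + s)) (j : ℤ) (m : M) :
    gradedProj h'.isInternal (j + s) (f m) = f (gradedProj h.isInternal j m) := by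
  induction m using h.induction with
  | mem k x hx =>
    by_cases hk : k = j
    · subst hk
      rw [h.proj_self hx, h'.proj_self (hf _ _ hx)]
    · rw [h.proj_of_ne hk hx, map_zero]
      exact h'.proj_of_ne (by omega) (hf _ _ hx)
  | zero => simp
  | add x y hx hy => simp only [map_add, hx, hy]

theorem map_proj_zero (h : IsGradedModule 𝒜 ℳ) (h' : IsGradedModule 𝒜 𝒩) (f : M →+ N)
    (hf : ∀ j, ∀ x ∈ ℳ j, f x ∈ 𝒩 j) (j : ℤ) (m : M) :
    gradedProj h'.isInternal j (f m) = f (gradedProj h.isInternal j m) := by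
  have := map_proj h h' (s := 0) f (fun j x hx => by rw [add_zero]; exact hf j x hx) j m
  rwa [add_zero] at this

end IsGradedModule

/-- A submodule that contains the components of its elements is graded. -/
theorem IsGradedModule.submodule (h : IsGradedModule 𝒜 ℳ) (K : Submodule A M)
    (hK : ∀ j, ∀ x ∈ K, gradedProj h.isInternal j x ∈ K) :
    IsGradedModule 𝒜 fun j => (ℳ j).comap K.subtype.toAddMonoidHom where
  isInternal := by
    refine isInternal_of_projections
      (fun j => ((gradedProj h.isInternal j).comp K.subtype.toAddMonoidHom).codRestrict K
        fun x => hK j x.1 x.2) ?_ ?_ ?_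
    · intro j m hm
      exact Subtype.ext (h.proj_self hm)
    · intro i j hij m hm
      exact Subtype.ext (h.proj_of_ne hij hm)
    · intro m
      have : m.1 ∈ (⨆ j, (ℳ j).comap K.subtype.toAddMonoidHom).map K.subtype.toAddMonoidHom := by
        refine h.mem_of_proj_mem _ fun j => ⟨⟨_, hK j m.1 m.2⟩, ?_, rfl⟩
        exact AddSubgroup.mem_iSup_of_mem j (h.proj_mem j m.1)
      obtain ⟨y, hy, hym⟩ := this
      rwa [show m = y from Subtype.ext hym.symm]
  smul_mem i j a ha m hm := h.smul_mem i j a ha m.1 hm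

theorem IsGradedModule.shift (h : IsGradedModule 𝒜 ℳ) (k : ℤ) :
    IsGradedModule 𝒜 fun j => ℳ (j + k) where
  isInternal := by
    refine isInternal_of_projections (fun j => gradedProj h.isInternal (j + k)) ?_ ?_ ?_
    · intro j m hm
      exact h.proj_self hm
    · intro i j hij m hm
      exact h.proj_of_ne (by omega) hm
    · intro m
      refine h.mem_of_proj_mem _ fun j => ?_
      refine AddSubgroup.mem_iSup_of_mem (j - k) ?_
      rw [sub_add_cancel]
      exact h.proj_mem j m
  smul_mem i j a ha m hm := by
    rw [add_assoc]
    exact h.smul_mem i _ a ha m hm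

open Classical in
theorem IsGradedModule.directSum {ι : Type*} {X : ι → Type*} [∀ α, AddCommGroup (X α)]
    [∀ α, Module A (X α)] {𝒳 : ∀ α, ℤ → AddSubgroup (X α)} (h : ∀ α, IsGradedModule 𝒜 (𝒳 α)) :
    IsGradedModule (M := ⨁ α, X α) 𝒜 fun j =>
      { carrier := {f | ∀ α, f α ∈ 𝒳 α j}
        zero_mem' := fun _ => zero_mem _
        add_mem' := fun hf hg α => add_mem (hf α) (hg α)
        neg_mem' := fun hf α => neg_mem (hf α) } where
  isInternal := by
    refine isInternal_of_projections
      (fun j => DFinsupp.mapRange.addMonoidHom fun α => gradedProj (h α).isInternal j) ?_ ?_ ?_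
    · intro j m hm
      refine DFinsupp.ext fun α => ?_
      exact (h α).proj_self (hm α)
    · intro i j hij m hm
      refine DFinsupp.ext fun α => ?_
      exact (h α).proj_of_ne hij (hm α)
    · intro m
      induction m using DirectSum.induction_on with
      | zero => exact zero_mem _
      | add x y hx hy => exact add_mem hx hy
      | of α x =>
        induction x using (h α).induction with
        | mem j x hx =>
          refine AddSubgroup.mem_iSup_of_mem j fun β => ?_
          by_cases hβ : β = α
          · subst hβ
            rwa [DirectSum.of_eq_same]
          · rw [DirectSum.of_eq_of_ne _ _ _ hβ]
            exact zero_mem _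
        | zero => rw [map_zero]; exact zero_mem _
        | add x y hx hy => rw [map_add]; exact add_mem hx hy
  smul_mem i j a ha _ hm α := (h α).smul_mem i j a ha _ (hm α)

/-- A homomorphism between graded modules has a component of degree `0`. -/
theorem IsGradedModule.exists_degreeZero_part [GradedRing 𝒜] (h : IsGradedModule 𝒜 ℳ)
    (h' : IsGradedModule 𝒜 𝒩) (f : M →ₗ[A] N) : ∃ g : M →ₗ[A] N,
      ∀ j, ∀ x ∈ ℳ j, g x = gradedProj h'.isInternal j (f x) := by
  let g : M →+ N := (DirectSum.toAddMonoid fun j =>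
      ((gradedProj h'.isInternal j).comp f.toAddMonoidHom).comp (ℳ j).subtype).comp
    (AddEquiv.ofBijective (DirectSum.coeAddMonoidHom ℳ) h.isInternal).symm.toAddMonoidHom
  have hg : ∀ j, ∀ x ∈ ℳ j, g x = gradedProj h'.isInternal j (f x) := by
    intro j x hx
    change DirectSum.toAddMonoid _
      ((AddEquiv.ofBijective (DirectSum.coeAddMonoidHom ℳ) h.isInternal).symm x) = _
    rw [h.equiv_symm_of_mem hx, DirectSum.toAddMonoid_of]
    rfl
  refine ⟨{ g with map_smul' := fun a x => ?_ }, hg⟩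
  change g (a • x) = a • g x
  induction a using DirectSum.Decomposition.inductionOn 𝒜 with
  | zero => simp
  | add a b ha hb => rw [add_smul, map_add, ha, hb, add_smul]
  | @homogeneous i a =>
    induction x using h.induction with
    | mem j x hx =>
      rw [hg j x hx, hg _ _ (h.smul_mem i j a a.2 x hx), map_smul, h'.proj_smul a.2]
    | zero => simp
    | add x y hx hy => rw [smul_add, map_add, hx, hy, map_add, smul_add]

/-- Graded homomorphisms lift along graded epimorphisms if the source is projective. -/
theorem IsGradedModule.exists_lift [GradedRing 𝒜] {P : Type*} [AddCommGroup P] [Module A P]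
    {𝒬 : ℤ → AddSubgroup P} (hP : IsGradedModule 𝒜 𝒬) [Module.Projective A P]
    (hM : IsGradedModule 𝒜 ℳ) (hN : IsGradedModule 𝒜 𝒩) (π : M →ₗ[A] N)
    (hπ : ∀ j, ∀ x ∈ ℳ j, π x ∈ 𝒩 j) (hsurj : Function.Surjective π) (f : P →ₗ[A] N)
    (hf : ∀ j, ∀ x ∈ 𝒬 j, f x ∈ 𝒩 j) :
    ∃ g : P →ₗ[A] M, (∀ j, ∀ x ∈ 𝒬 j, g x ∈ ℳ j) ∧ ∀ x, π (g x) = f x := by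
  obtain ⟨g₀, hg₀⟩ := Module.projective_lifting_property π f hsurj
  -- The part of degree 0 of an ungraded lift is still a lift, because `π` and `f` commute with the
  -- projections.
  obtain ⟨g, hg⟩ := hP.exists_degreeZero_part hM g₀
  refine ⟨g, fun j x hx => by rw [hg j x hx]; exact hM.proj_mem _ _, fun x => ?_⟩
  induction x using hP.induction with
  | mem j x hx =>
    have := map_proj_zero hM hN π.toAddMonoidHom hπ j (g₀ x)
    rw [hg j x hx]
    refine this.symm.trans ?_
    have e : π.toAddMonoidHom (g₀ x) = f x := DFunLike.congr_fun hg₀ x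
    rw [e]
    exact hN.proj_self (hf j x hx)
  | zero => simp
  | add x y hx hy => simp only [map_add, hx, hy]

/-- The components of a graded module that is generated in degree `d`. -/
theorem IsGradedModule.mem_closure_of_generated [GradedRing 𝒜] (h : IsGradedModule 𝒜 ℳ) {d : ℤ}
    (hgen : IsGeneratedInDegree A ℳ d) {j : ℤ} {x : M} (hx : x ∈ ℳ j) :
    x ∈ AddSubgroup.closure {y | ∃ i : ℕ, (i : ℤ) + d = j ∧ ∃ a ∈ 𝒜 i, ∃ m ∈ ℳ d, y = a • m} := by
  have key : ∀ z : M, gradedProj h.isInternal j z ∈ AddSubgroup.closure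
      {y | ∃ i : ℕ, (i : ℤ) + d = j ∧ ∃ a ∈ 𝒜 i, ∃ m ∈ ℳ d, y = a • m} := by
    intro z
    have hz : z ∈ Submodule.span A (ℳ d : Set M) := by
      rw [hgen]
      trivial
    induction hz using Submodule.span_induction with
    | mem z hz =>
      by_cases hj : d = j
      · subst hj
        rw [h.proj_self hz]
        refine AddSubgroup.subset_closure ⟨0, by simp, 1, SetLike.GradedOne.one_mem, z, hz, ?_⟩
        rw [one_smul]
      · rw [h.proj_of_ne hj hz]
        exact zero_mem _
    | zero => rw [map_zero]; exact zero_mem _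
    | add y z _ _ hy hz => rw [map_add]; exact add_mem hy hz
    | smul a z hz ih =>
      -- The hypothesis concerns only the component of degree `j` of `z`, while that of `a • z`
      -- involves other components of `z`. So `a` is taken homogeneous and the span induction is
      -- redone with its degree varying.
      clear ih
      induction a using DirectSum.Decomposition.inductionOn 𝒜 with
      | zero => simp
      | add a b ha hb => rw [add_smul, map_add]; exact add_mem ha hb
      | @homogeneous i a => 
        induction hz using Submodule.span_induction generalizing i with
        | mem z hz =>
          by_cases hj : (i : ℤ) + d = j
          · subst hj
            rw [h.proj_self (h.smul_mem i d a a.2 z hz)]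
            exact AddSubgroup.subset_closure ⟨i, rfl, a, a.2, z, hz, rfl⟩
          · rw [h.proj_of_ne hj (h.smul_mem i d a a.2 z hz)]
            exact zero_mem _
        | zero => simp
        | add y z _ _ hy hz => rw [smul_add, map_add]; exact add_mem (@hy _ _) (@hz _ _)
        | smul b z _ hz =>
          induction b using DirectSum.Decomposition.inductionOn 𝒜 with
          | zero => simp
          | add a b ha hb => rw [add_smul, smul_add, map_add]; exact add_mem ha hb
          | @homogeneous k b =>
            have := @hz (i + k) ⟨a * b, SetLike.GradedMul.mul_mem a.2 b.2⟩
            rwa [smul_smul]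
  rw [← h.proj_self hx]
  exact key x

/-- The ring has no negative degrees, so it cannot lower the degree of a generator. For a linear
resolution this makes the augmentation injective in degree 0. -/
theorem IsGradedModule.eq_bot_of_generated [GradedRing 𝒜] (h : IsGradedModule 𝒜 ℳ) {d : ℤ}
    (hgen : IsGeneratedInDegree A ℳ d) {j : ℤ} (hj : j < d) {x : M} (hx : x ∈ ℳ j) : x = 0 := by
  have := h.mem_closure_of_generated hgen hx
  clear hx
  induction this using AddSubgroup.closure_induction with
  | mem y hy => obtain ⟨i, hi, _⟩ := hy; omega
  | zero => rfl
  | add y z _ _ hy hz => rw [hy, hz, add_zero]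
  | neg y _ hy => rw [hy, neg_zero]

theorem IsGeneratedInDegree.linearMap_ext {d : ℤ} (hgen : IsGeneratedInDegree A ℳ d)
    {f g : M →ₗ[A] N} (hfg : ∀ x ∈ ℳ d, f x = g x) : f = g :=
  LinearMap.ext_on hgen hfg

theorem IsGradedModule.extendByZero {ℳ : ℕ → AddSubgroup M} (hM : DirectSum.IsInternal ℳ)
    (hsmul : ∀ i j : ℕ, ∀ a ∈ 𝒜 i, ∀ m ∈ ℳ j, a • m ∈ ℳ (i + j)) :
    IsGradedModule 𝒜 (extendByZero ℳ) where
  isInternal := by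
    let e := AddEquiv.ofBijective (DirectSum.coeAddMonoidHom ℳ) hM
    let p : ℕ → M →+ M := fun j => (ℳ j).subtype.comp
      ((DFinsupp.evalAddMonoidHom (β := fun i => ℳ i) j).comp e.symm.toAddMonoidHom)
    have he : ∀ j m (hm : m ∈ ℳ j), e.symm m = DirectSum.of (fun i => ℳ i) j ⟨m, hm⟩ := by
      intro j m hm
      rw [AddEquiv.symm_apply_eq]
      exact (DirectSum.coeAddMonoidHom_of ℳ j ⟨m, hm⟩).symm
    refine isInternal_of_projections
      (fun j => match j with | Int.ofNat n => p n | Int.negSucc _ => 0) ?_ ?_ ?_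
    · rintro (j | j) m hm
      · change Subtype.val ((e.symm m) j) = m
        rw [he j m hm]
        exact congrArg Subtype.val (DirectSum.of_eq_same (β := fun i => ℳ i) j ⟨m, hm⟩)
      · exact (AddSubgroup.mem_bot.1 hm).symm
    · rintro i (j | j) hij m hm
      · rcases i with i | i
        · change Subtype.val ((e.symm m) j) = 0
          rw [he i m hm]
          refine congrArg Subtype.val
            (DirectSum.of_eq_of_ne (β := fun i => ℳ i) i j ⟨m, hm⟩ ?_)
          rintro rfl
          exact hij rfl
        · rw [AddSubgroup.mem_bot.1 hm, map_zero]
      · rfl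
    · intro m
      have hm : m ∈ ⨆ j, ℳ j := mem_iSup_of_isInternal hM m
      have hle : (⨆ j, ℳ j) ≤ ⨆ j, GradedKoszul.extendByZero ℳ j :=
        iSup_le fun j => le_iSup (GradedKoszul.extendByZero ℳ) (Int.ofNat j)
      exact hle hm
  smul_mem := by
    rintro i (j | j) a ha m hm
    · exact hsmul i j a ha m hm
    · rw [AddSubgroup.mem_bot.1 hm, smul_zero]
      exact zero_mem _

theorem isGradedModule_self [GradedRing 𝒜] : IsGradedModule 𝒜 (extendByZero 𝒜) :=
  .extendByZero (DirectSum.Decomposition.isInternal 𝒜) fun _ _ _ ha _ hb =>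
    SetLike.GradedMul.mul_mem ha hb

theorem extendByZero_natCast (ℳ : ℕ → AddSubgroup M) (n : ℕ) : extendByZero ℳ (n : ℤ) = ℳ n := rfl

theorem extendByZero_of_neg (ℳ : ℕ → AddSubgroup M) {j : ℤ} (hj : j < 0) :
    extendByZero ℳ j = ⊥ := by
  rcases j with j | j
  · exact absurd hj (by simp)
  · rfl

end GradedModules

/-! ### Separation of the radical filtration -/

section Radical

variable {A : Type u} [Ring A]

theorem ideal_pow_succ_smul {M : Type*} [AddCommGroup M] [Module A M] (I : Ideal A) [I.IsTwoSided]
    (n : ℕ) (N : Submodule A M) : I ^ (n + 1) • N = I • I ^ n • N := by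
  rw [Ideal.IsTwoSided.pow_succ, ← Submodule.smul_assoc]
  rfl

theorem ideal_pow_add_smul {M : Type*} [AddCommGroup M] [Module A M] (I : Ideal A) [I.IsTwoSided]
    (m n : ℕ) (N : Submodule A M) : I ^ (m + n) • N = I ^ m • I ^ n • N := by
  rw [Ideal.IsTwoSided.pow_add, ← Submodule.smul_assoc]
  rfl

theorem ideal_pow_zero_smul {M : Type*} [AddCommGroup M] [Module A M] (I : Ideal A)
    (N : Submodule A M) : I ^ 0 • N = N := by
  rw [Submodule.pow_zero, Submodule.one_smul]

theorem ideal_pow_smul_le {M : Type*} [AddCommGroup M] [Module A M] (I : Ideal A) [I.IsTwoSided]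
    {m n : ℕ} (h : m ≤ n) (N : Submodule A M) : I ^ n • N ≤ I ^ m • N := by
  obtain ⟨k, rfl⟩ := Nat.exists_eq_add_of_le h
  rw [ideal_pow_add_smul]
  exact Submodule.smul_mono le_rfl Submodule.smul_le_right

theorem pow_mem_ideal_pow (I : Ideal A) {x : A} (hx : x ∈ I) (n : ℕ) : x ^ n ∈ I ^ n := by
  induction n with
  | zero => rw [Submodule.pow_zero, Ideal.one_eq_top]; trivial
  | succ n ih => rw [pow_succ, Submodule.pow_succ]; exact Ideal.mul_mem_mul ih hx

theorem exists_jacobson_pow_eq_bot (R : Type*) [Ring R] [IsArtinianRing R] :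
    ∃ n : ℕ, Ring.jacobson R ^ n = ⊥ :=
  IsSemiprimaryRing.isNilpotent (R := R)

variable {𝒜 : ℕ → AddSubgroup A} [GradedRing 𝒜]

/-! ### The graded radical, its components, and its powers -/

theorem mem_positivePart_iff {a : A} :
    a ∈ positivePart 𝒜 ↔ (DirectSum.decompose 𝒜 a 0 : A) = 0 := by
  rw [RingHom.mem_ker, ← Subtype.coe_inj]
  rfl

theorem positivePart_le_gradedJacobson : positivePart 𝒜 ≤ gradedJacobson 𝒜 := by
  intro a ha
  rw [RingHom.mem_ker] at ha
  rw [Ideal.mem_comap, ha]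
  exact zero_mem _

theorem mem_positivePart_of_mem {k : ℕ} (hk : k ≠ 0) {a : A} (ha : a ∈ 𝒜 k) :
    a ∈ positivePart 𝒜 := by
  rw [mem_positivePart_iff, DirectSum.decompose_of_mem_ne 𝒜 ha hk]

theorem decompose_mem_gradedJacobson {a : A} (ha : a ∈ gradedJacobson 𝒜) (k : ℕ) :
    (DirectSum.decompose 𝒜 a k : A) ∈ gradedJacobson 𝒜 := by
  by_cases hk : k = 0
  · subst hk
    rw [Ideal.mem_comap, GradedRing.projZeroRingHom'_apply_coe]
    exact ha
  · exact positivePart_le_gradedJacobson (mem_positivePart_of_mem hk (SetLike.coe_mem _))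

/-- Modulo `A_{≥1}` the ideal `J` becomes `J(A_0)`, which is nilpotent as `A_0` is artinian. This
links the `J`-adic filtration to the filtration by degree. -/
theorem exists_gradedJacobson_pow_le_positivePart (𝒜 : ℕ → AddSubgroup A) [GradedRing 𝒜]
    [IsArtinianRing (𝒜 0)] : ∃ n : ℕ, gradedJacobson 𝒜 ^ n ≤ positivePart 𝒜 := by
  obtain ⟨n, hn⟩ := exists_jacobson_pow_eq_bot (𝒜 0)
  have key : ∀ m : ℕ, gradedJacobson 𝒜 ^ m ≤
      (Ring.jacobson (𝒜 0) ^ m).comap (GradedRing.projZeroRingHom' 𝒜) := by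
    intro m
    induction m with
    | zero =>
      intro x _
      rw [Ideal.mem_comap, Submodule.pow_zero, Ideal.one_eq_top]
      trivial
    | succ m ih =>
      rw [Submodule.pow_succ, Ideal.mul_le]
      intro x hx y hy
      rw [Ideal.mem_comap, map_mul, Submodule.pow_succ]
      exact Ideal.mul_mem_mul (ih hx) hy
  refine ⟨n, fun x hx => ?_⟩
  have := key n hx
  rwa [Ideal.mem_comap, hn] at this

variable {M : Type v} [AddCommGroup M] [Module A M] {ℳ : ℤ → AddSubgroup M}

namespace IsGradedModule

variable (h : IsGradedModule 𝒜 ℳ)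

open Classical in
theorem proj_smul_eq_sum (a : A) (j : ℤ) (m : M) : gradedProj h.isInternal j (a • m) =
    ∑ k ∈ (DirectSum.decompose 𝒜 a).support,
      (DirectSum.decompose 𝒜 a k : A) • gradedProj h.isInternal (j - k) m := by
  conv_lhs => rw [← DirectSum.sum_support_decompose 𝒜 a]
  rw [Finset.sum_smul, map_sum]
  exact Finset.sum_congr rfl fun k _ => h.proj_smul' (SetLike.coe_mem _) j m

/-- The submodule of the elements without components of degree less than `j`. -/
def geSubmodule (j : ℤ) : Submodule A M where
  carrier := {x | ∀ i < j, gradedProj h.isInternal i x = 0}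
  zero_mem' i _ := map_zero _
  add_mem' hx hy i hi := by rw [map_add, hx i hi, hy i hi, add_zero]
  smul_mem' a x hx i hi := by
    rw [h.proj_smul_eq_sum]
    refine Finset.sum_eq_zero fun k _ => ?_
    rw [hx _ (by omega), smul_zero]

theorem positivePart_smul_geSubmodule_le (j : ℤ) :
    positivePart 𝒜 • h.geSubmodule j ≤ h.geSubmodule (j + 1) := by
  refine Submodule.smul_le.2 fun a ha x hx i hi => ?_
  rw [h.proj_smul_eq_sum]
  refine Finset.sum_eq_zero fun k _ => ?_
  by_cases hk : k = 0
  · subst hk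
    rw [mem_positivePart_iff.1 ha, zero_smul]
  · rw [hx _ (by omega), smul_zero]

/-- If `J^N ⊆ A_{≥1}` and `M` vanishes below degree `l`, each further block of `N` factors raises
the bound by one: `J^(Nk) M` vanishes below degree `l + k`. -/
theorem exists_proj_pow_smul_eq_zero [IsArtinianRing (𝒜 0)] (hb : IsBoundedBelow ℳ) (j : ℤ) :
    ∃ m : ℕ, ∀ x ∈ gradedJacobson 𝒜 ^ m • (⊤ : Submodule A M),
      gradedProj h.isInternal j x = 0 := by
  obtain ⟨l, hl⟩ := hb
  obtain ⟨N, hN⟩ := exists_gradedJacobson_pow_le_positivePart 𝒜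
  have key : ∀ k : ℕ, gradedJacobson 𝒜 ^ (N * k) • (⊤ : Submodule A M) ≤
      h.geSubmodule (l + k) := by
    intro k
    induction k with
    | zero =>
      intro x _ i hi
      have := h.proj_mem i x
      rwa [hl i (by simpa using hi), AddSubgroup.mem_bot] at this
    | succ k ih =>
      rw [show N * (k + 1) = N + N * k by ring, ideal_pow_add_smul]
      refine (Submodule.smul_mono hN ih).trans ?_
      refine (h.positivePart_smul_geSubmodule_le _).trans (le_of_eq ?_)
      congr 1
      push_cast
      ring
  refine ⟨N * (j + 1 - l).toNat, fun x hx => key _ hx j ?_⟩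
  omega

/-- A graded submodule is closed in the `J`-adic topology: in each single degree the term `J^m M`
disappears for large `m`. This replaces finiteness assumptions, both in Nakayama's lemma and in the
final step of the successive approximation. -/
theorem mem_of_forall_mem_sup [IsArtinianRing (𝒜 0)] (hb : IsBoundedBelow ℳ) (N : Submodule A M)
    (hN : ∀ j, ∀ x ∈ N, gradedProj h.isInternal j x ∈ N) {x : M}
    (hx : ∀ m : ℕ, x ∈ N ⊔ gradedJacobson 𝒜 ^ m • (⊤ : Submodule A M)) : x ∈ N := by
  refine h.mem_of_proj_mem N.toAddSubgroup fun j => ?_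
  obtain ⟨m, hm⟩ := h.exists_proj_pow_smul_eq_zero hb j
  obtain ⟨y, hy, z, hz, rfl⟩ := Submodule.mem_sup.1 (hx m)
  rw [map_add, hm z hz, add_zero]
  exact hN j y hy

theorem proj_mem_smul (N : Submodule A M) (hN : ∀ j, ∀ x ∈ N, gradedProj h.isInternal j x ∈ N)
    (j : ℤ) (x : M) (hx : x ∈ gradedJacobson 𝒜 • N) :
    gradedProj h.isInternal j x ∈ gradedJacobson 𝒜 • N := by
  induction hx using Submodule.smul_induction_on' with
  | smul a ha n hn =>
    rw [h.proj_smul_eq_sum]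
    exact sum_mem fun k _ => Submodule.smul_mem_smul (decompose_mem_gradedJacobson ha k) (hN _ n hn)
  | add x _ y _ hx hy => rw [map_add]; exact add_mem hx hy

theorem proj_mem_pow_smul (N : Submodule A M) (hN : ∀ j, ∀ x ∈ N, gradedProj h.isInternal j x ∈ N)
    (n : ℕ) (j : ℤ) (x : M) (hx : x ∈ gradedJacobson 𝒜 ^ n • N) :
    gradedProj h.isInternal j x ∈ gradedJacobson 𝒜 ^ n • N := by
  induction n generalizing j x with
  | zero =>
    rw [ideal_pow_zero_smul] at hx ⊢
    exact hN j x hx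
  | succ n ih =>
    rw [ideal_pow_succ_smul] at hx ⊢
    exact h.proj_mem_smul _ ih j x hx

/-- Nakayama's lemma for graded submodules of bounded below modules. -/
theorem eq_top_of_sup_eq_top [IsArtinianRing (𝒜 0)] (hb : IsBoundedBelow ℳ) (N : Submodule A M)
    (hN : ∀ j, ∀ x ∈ N, gradedProj h.isInternal j x ∈ N)
    (hsup : N ⊔ gradedJacobson 𝒜 • (⊤ : Submodule A M) = ⊤) : N = ⊤ := by
  -- The equation `M = N + JM` is substituted into itself `m` times.
  have key : ∀ m : ℕ, N ⊔ gradedJacobson 𝒜 ^ m • (⊤ : Submodule A M) = ⊤ := by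
    intro m
    induction m with
    | zero => rw [ideal_pow_zero_smul, sup_top_eq]
    | succ m ih =>
      refine top_le_iff.1 (ih.symm.le.trans ?_)
      refine sup_le le_sup_left ?_
      have h1 : gradedJacobson 𝒜 ^ m • (⊤ : Submodule A M) =
          gradedJacobson 𝒜 ^ m • N ⊔ gradedJacobson 𝒜 ^ (m + 1) • (⊤ : Submodule A M) := by
        have h2 := ideal_pow_add_smul (gradedJacobson 𝒜) m 1 (⊤ : Submodule A M)
        rw [Submodule.pow_one] at h2
        have h3 := Submodule.smul_sup (gradedJacobson 𝒜 ^ m) N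
          (gradedJacobson 𝒜 • (⊤ : Submodule A M))
        rw [hsup] at h3
        rw [h2, h3]
      have h4 : gradedJacobson 𝒜 ^ m • N ≤ N := Submodule.smul_le_right
      exact le_trans (le_of_eq h1) (sup_le_sup_right h4 _)
  exact eq_top_iff.2 fun x _ => h.mem_of_forall_mem_sup hb N hN fun m => (key m).symm ▸ trivial

end IsGradedModule

/-! ### Projective covers -/

/-- The homomorphism from `A` onto the semisimple ring `A_0 / J(A_0)`. -/
def toSemisimpleQuotient (𝒜 : ℕ → AddSubgroup A) [GradedRing 𝒜] :
    A →+* (𝒜 0) ⧸ Ring.jacobson (𝒜 0) :=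
  (Ideal.Quotient.mk (Ring.jacobson (𝒜 0))).comp (GradedRing.projZeroRingHom' 𝒜)

theorem toSemisimpleQuotient_surjective : Function.Surjective (toSemisimpleQuotient 𝒜) :=
  Ideal.Quotient.mk_surjective.comp (GradedRing.projZeroRingHom'_surjective 𝒜)

theorem toSemisimpleQuotient_eq_zero_iff {a : A} :
    toSemisimpleQuotient 𝒜 a = 0 ↔ a ∈ gradedJacobson 𝒜 :=
  Ideal.Quotient.eq_zero_iff_mem

theorem isSemisimpleRing_quotient_of_ker_eq {R : Type*} [Ring R] [IsSemisimpleRing R] (f : A →+* R)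
    (hf : Function.Surjective f) (I : Ideal A) [I.IsTwoSided] (hI : RingHom.ker f = I) :
    IsSemisimpleRing (A ⧸ I) := by
  subst hI
  exact (RingHom.quotientKerEquivOfSurjective hf).symm.isSemisimpleRing

variable (𝒜 M) in
theorem isSemisimpleModule_quotient_gradedJacobson [IsArtinianRing (𝒜 0)] :
    IsSemisimpleModule A (M ⧸ gradedJacobson 𝒜 • (⊤ : Submodule A M)) := by
  have : IsSemisimpleRing (A ⧸ gradedJacobson 𝒜) :=
    isSemisimpleRing_quotient_of_ker_eq (toSemisimpleQuotient 𝒜) toSemisimpleQuotient_surjective _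
      (Ideal.ext fun a => toSemisimpleQuotient_eq_zero_iff)
  -- The quotient has the same submodules over `A` and over the semisimple ring `A/J`; the identity,
  -- seen as a semilinear map, transfers semisimplicity.
  let l : (M ⧸ gradedJacobson 𝒜 • (⊤ : Submodule A M)) →ₛₗ[Ideal.Quotient.mk (gradedJacobson 𝒜)]
      (M ⧸ gradedJacobson 𝒜 • (⊤ : Submodule A M)) :=
    { AddMonoidHom.id _ with map_smul' := fun _ _ => rfl }
  have : RingHomSurjective (Ideal.Quotient.mk (gradedJacobson 𝒜)) :=
    ⟨Ideal.Quotient.mk_surjective⟩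
  exact (LinearMap.isSemisimpleModule_iff_of_bijective l Function.bijective_id).2 inferInstance

/-- In a semisimple ring every left ideal is the annihilator of an idempotent. -/
theorem exists_idempotent_of_isSemisimpleRing {R : Type*} [Ring R] [IsSemisimpleRing R]
    (L : Ideal R) : ∃ e : R, e * e = e ∧ 1 - e ∈ L ∧ ∀ a ∈ L, a * e = 0 := by
  obtain ⟨L', hL'⟩ := exists_isCompl L
  have h1 : (1 : R) ∈ L ⊔ L' := hL'.sup_eq_top ▸ trivial
  obtain ⟨f, hf, e, he, hfe⟩ := Submodule.mem_sup.1 h1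
  have h0 : ∀ x, x ∈ L → x ∈ L' → x = 0 := fun x hx hx' =>
    Submodule.disjoint_def.1 hL'.disjoint x hx hx'
  refine ⟨e, ?_, ?_, ?_⟩
  · have h2 : e * f = 0 := by
      refine h0 _ (L.mul_mem_left _ hf) ?_
      have : e * f = e - e * e := by rw [eq_sub_iff_add_eq, ← mul_add, hfe, mul_one]
      rw [this]
      exact sub_mem he (L'.mul_mem_left _ he)
    have h3 : e * (f + e) = e := by rw [hfe, mul_one]
    rwa [mul_add, h2, zero_add] at h3
  · rwa [← hfe, add_sub_cancel_right]
  · intro a ha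
    have h3 : a * f + a * e = a := by rw [← mul_add, hfe, mul_one]
    refine h0 _ ?_ (L'.mul_mem_left _ he)
    rw [← eq_sub_iff_add_eq'] at h3
    rw [h3]
    exact sub_mem ha (L.mul_mem_left _ hf)

variable (𝒜) in
/-- The annihilator of an element of `M / JM` is generated modulo `J` by an idempotent. -/
theorem exists_idempotent_of_mem_quotient [IsArtinianRing (𝒜 0)] (x : M) :
    ∃ e ∈ 𝒜 0, e * e = e ∧ e • x - x ∈ gradedJacobson 𝒜 • (⊤ : Submodule A M) ∧
      ∀ a : A, a • x ∈ gradedJacobson 𝒜 • (⊤ : Submodule A M) → a * e ∈ gradedJacobson 𝒜 := by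
  set JM := gradedJacobson 𝒜 • (⊤ : Submodule A M) with hJM
  let I : Ideal A := JM.comap (LinearMap.toSpanSingleton A M x)
  have hI : ∀ a, a ∈ I ↔ a • x ∈ JM := fun a => Iff.rfl
  have hJI : gradedJacobson 𝒜 ≤ I := fun a ha => Submodule.smul_mem_smul ha trivial
  obtain ⟨ε, hε, hε1, hε0⟩ := exists_idempotent_of_isSemisimpleRing
    (I.map (toSemisimpleQuotient 𝒜))
  -- The idempotent is lifted along `A_0 → A_0/J(A_0)`, whose kernel consists of nilpotent elements.
  -- Lifting inside `A_0`, not `A`, keeps it homogeneous of degree 0.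
  obtain ⟨e, he, rfl⟩ := exists_isIdempotentElem_eq_of_ker_isNilpotent
    (Ideal.Quotient.mk (Ring.jacobson (𝒜 0))) (by
      intro y hy
      obtain ⟨n, hn⟩ := exists_jacobson_pow_eq_bot (𝒜 0)
      refine ⟨n, ?_⟩
      have := pow_mem_ideal_pow (Ring.jacobson (𝒜 0)) (by simpa using hy) n
      rwa [hn] at this) ε (Ideal.Quotient.mk_surjective ε) hε
  have hπe : toSemisimpleQuotient 𝒜 (e : A) = Ideal.Quotient.mk (Ring.jacobson (𝒜 0)) e := by
    rw [toSemisimpleQuotient, RingHom.comp_apply, GradedRing.projZeroRingHom'_apply_coe]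
  refine ⟨e, e.2, congrArg Subtype.val he, ?_, fun a ha => ?_⟩
  · obtain ⟨b, hb, hbe⟩ := (Ideal.mem_map_iff_of_surjective _
      toSemisimpleQuotient_surjective).1 hε1
    have h1 : (1 - (e : A)) - b ∈ gradedJacobson 𝒜 := by
      rw [← toSemisimpleQuotient_eq_zero_iff, map_sub, map_sub, hbe, hπe, map_one, sub_self]
    have h2 : 1 - (e : A) ∈ I := by
      have := add_mem (hJI h1) hb
      rwa [sub_add_cancel] at this
    rw [hI, sub_smul, one_smul] at h2
    rw [← neg_sub]
    exact neg_mem h2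
  · rw [← toSemisimpleQuotient_eq_zero_iff, map_mul, hπe]
    exact hε0 _ (Ideal.mem_map_of_mem _ ha)

/-- Zorn's lemma for independent subsets of a prescribed set `T` of atoms. Restricting to `T` is
what allows the simple summands of `M/JM` to be chosen homogeneous. -/
theorem exists_sSupIndep_subset_of_isAtom {α : Type*} [CompleteLattice α] [IsModularLattice α]
    [IsCompactlyGenerated α] (T : Set α) (hT : ∀ a ∈ T, IsAtom a) :
    ∃ s ⊆ T, sSupIndep s ∧ sSup s = sSup T := by
  have zorn := zorn_subset {s : Set α | sSupIndep s ∧ s ⊆ T} fun c hc1 hc2 =>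
    ⟨⋃₀ c, ⟨iSupIndep_sUnion_of_directed hc2.directedOn fun s hs => (hc1 hs).1,
      Set.sUnion_subset fun s hs => (hc1 hs).2⟩, fun _ => Set.subset_sUnion_of_mem⟩
  simp_rw [maximal_subset_iff] at zorn
  obtain ⟨s, ⟨s_ind, s_sub⟩, s_max⟩ := zorn
  refine ⟨s, s_sub, s_ind, le_antisymm (sSup_le_sSup s_sub) (sSup_le fun a ha => ?_)⟩
  rw [← inf_eq_left]
  refine ((hT a ha).le_iff.mp inf_le_left).resolve_left fun con => (hT a ha).1 ?_
  rw [← con, eq_comm, inf_eq_left]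
  refine le_sSup ?_
  rw [← disjoint_iff] at con
  rw [s_max ⟨fun x hx => ?_, ?_⟩ Set.subset_union_left]
  · exact Set.mem_union_right _ (Set.mem_singleton a)
  · exact Set.union_subset s_sub (Set.singleton_subset_iff.2 ha)
  · rw [Set.mem_union, Set.mem_singleton_iff] at hx
    obtain rfl | xa := eq_or_ne x a
    · simp only [Set.mem_singleton, Set.insert_sdiff_of_mem, Set.union_singleton]
      exact con.mono_right (sSup_le_sSup Set.sdiff_subset)
    · have h : (s ∪ {a}) \ {x} = s \ {x} ∪ {a} := by
        simp only [Set.union_singleton]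
        rw [Set.insert_sdiff_of_notMem]
        rw [Set.mem_singleton_iff]
        exact Ne.symm xa
      rw [h, sSup_union, sSup_singleton]
      apply
        (s_ind (hx.resolve_right xa)).disjoint_sup_right_of_disjoint_sup_left
          (con.mono_right _).symm
      rw [← sSup_insert, Set.insert_sdiff_singleton, Set.insert_eq_of_mem (hx.resolve_right xa)]

/-- On `M/JM` the ring acts through its component of degree 0, since `A_{≥1} ⊆ J`. Hence the image
of `M_j` is already a submodule. -/
theorem IsGradedModule.exists_mkQ_eq_of_mem_span (h : IsGradedModule 𝒜 ℳ) (j : ℤ)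
    {y : M ⧸ gradedJacobson 𝒜 • (⊤ : Submodule A M)}
    (hy : y ∈ Submodule.span A (Submodule.mkQ (gradedJacobson 𝒜 • (⊤ : Submodule A M)) '' ℳ j)) :
    ∃ x ∈ ℳ j, Submodule.mkQ (gradedJacobson 𝒜 • (⊤ : Submodule A M)) x = y := by
  induction hy using Submodule.span_induction with
  | mem y hy => exact hy
  | zero => exact ⟨0, zero_mem _, map_zero _⟩
  | add y z _ _ hy hz =>
    obtain ⟨y, hy, rfl⟩ := hy
    obtain ⟨z, hz, rfl⟩ := hz
    exact ⟨y + z, add_mem hy hz, map_add _ _ _⟩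
  | smul a y _ hy =>
    obtain ⟨y, hy, rfl⟩ := hy
    refine ⟨(DirectSum.decompose 𝒜 a 0 : A) • y, ?_, ?_⟩
    · have := h.smul_mem 0 j _ (SetLike.coe_mem (DirectSum.decompose 𝒜 a 0)) y hy
      rwa [Nat.cast_zero, zero_add] at this
    · rw [← map_smul, ← sub_eq_zero, ← map_sub, ← sub_smul, Submodule.mkQ_apply,
        Submodule.Quotient.mk_eq_zero]
      refine Submodule.smul_mem_smul (positivePart_le_gradedJacobson ?_) trivial
      rw [mem_positivePart_iff, DirectSum.decompose_sub, DirectSum.decompose_coe]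
      simp

/-- Homogeneous generators of `M / JM` with matching idempotents. -/
theorem IsGradedModule.exists_generators [IsArtinianRing (𝒜 0)] (h : IsGradedModule 𝒜 ℳ) :
    ∃ (ι : Type v) (deg : ι → ℤ) (x : ι → M) (e : ι → A),
      (∀ i, x i ∈ ℳ (deg i)) ∧ (∀ i, x i ≠ 0) ∧ (∀ i, e i ∈ 𝒜 0) ∧ (∀ i, e i * e i = e i) ∧
      (∀ i, e i • x i = x i) ∧
      (∀ i, ∀ a : A, a • x i ∈ gradedJacobson 𝒜 • (⊤ : Submodule A M) →
        a * e i ∈ gradedJacobson 𝒜) ∧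
      iSupIndep (fun i => Submodule.span A
        {Submodule.mkQ (gradedJacobson 𝒜 • (⊤ : Submodule A M)) (x i)}) ∧
      (⨆ i, Submodule.span A
        {Submodule.mkQ (gradedJacobson 𝒜 • (⊤ : Submodule A M)) (x i)}) = ⊤ := by
  set π := Submodule.mkQ (gradedJacobson 𝒜 • (⊤ : Submodule A M)) with hπ
  have hss := isSemisimpleModule_quotient_gradedJacobson 𝒜 M
  let V : ℤ → Submodule A (M ⧸ gradedJacobson 𝒜 • (⊤ : Submodule A M)) :=
    fun j => Submodule.span A (π '' ℳ j)
  -- Only simple submodules inside a single homogeneous component are admitted. They still span,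
  -- because each component is semisimple and the components generate.
  obtain ⟨s, hsT, hind, hsup⟩ := exists_sSupIndep_subset_of_isAtom
    {N : Submodule A (M ⧸ gradedJacobson 𝒜 • (⊤ : Submodule A M)) | IsAtom N ∧ ∃ j, N ≤ V j}
    fun N hN => hN.1
  have hV : ∀ j, V j ≤ sSup s := by
    intro j
    rw [hsup, ← IsSemisimpleModule.sSup_simples_le (V j)]
    exact sSup_le_sSup fun N hN => ⟨isSimpleModule_iff_isAtom.1 hN.1, j, hN.2⟩
  have htop : sSup s = ⊤ := by
    rw [eq_top_iff]
    intro y _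
    obtain ⟨x, rfl⟩ := Submodule.mkQ_surjective _ y
    induction x using h.induction with
    | mem j x hx => exact hV j (Submodule.subset_span ⟨x, hx, rfl⟩)
    | zero => rw [map_zero]; exact zero_mem _
    | add x y hx hy => rw [map_add]; exact add_mem (hx trivial) (hy trivial)
  have hchoose : ∀ N : s, ∃ (d : ℤ) (x : M) (e : A), x ∈ ℳ d ∧ x ≠ 0 ∧ e ∈ 𝒜 0 ∧ e * e = e ∧
      e • x = x ∧ (∀ a : A, a • x ∈ gradedJacobson 𝒜 • (⊤ : Submodule A M) →
        a * e ∈ gradedJacobson 𝒜) ∧ Submodule.span A {π x} = N.1 := by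
    rintro ⟨N, hN⟩
    obtain ⟨hatom, d, hd⟩ := hsT hN
    obtain ⟨y, hy, hy0⟩ := Submodule.exists_mem_ne_zero_of_ne_bot hatom.1
    obtain ⟨x, hx, rfl⟩ := h.exists_mkQ_eq_of_mem_span d (hd hy)
    obtain ⟨e, he, hee, hex, hea⟩ := exists_idempotent_of_mem_quotient 𝒜 x
    have hπx : π (e • x) = π x := by
      rw [← sub_eq_zero, ← map_sub, hπ, Submodule.mkQ_apply, Submodule.Quotient.mk_eq_zero]
      exact hex
    -- Replacing `x` by `e • x` does not change its class modulo `JM` and makes it fixed by `e`, so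
    -- that `A e → M` can send `e` to it.
    refine ⟨d, e • x, e, ?_, ?_, he, hee, ?_, ?_, ?_⟩
    · have := h.smul_mem 0 d e he x hx
      rwa [Nat.cast_zero, zero_add] at this
    · intro h0
      rw [h0, map_zero] at hπx
      exact hy0 hπx.symm
    · rw [smul_smul, hee]
    · intro a ha
      refine hea a ?_
      rw [← Submodule.Quotient.mk_eq_zero, ← Submodule.mkQ_apply] at ha ⊢
      rw [map_smul] at ha ⊢
      rwa [← hπx]
    · rw [hπx]
      have hle : Submodule.span A {π x} ≤ N := (Submodule.span_singleton_le_iff_mem _ _).2 hy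
      refine (hatom.le_iff.1 hle).resolve_left fun h0 => hy0 ?_
      exact Submodule.span_singleton_eq_bot.1 h0
  choose deg x e h1 h2 h3 h4 h5 h6 h7 using hchoose
  refine ⟨s, deg, x, e, h1, h2, h3, h4, h5, h6, ?_, ?_⟩
  · simp_rw [h7]
    exact (sSupIndep_iff s).1 hind
  · simp_rw [h7]
    rw [← sSup_eq_iSup', htop]

theorem mem_span_idempotent_iff {e : A} (he : e * e = e) {a : A} :
    a ∈ Submodule.span A {e} ↔ a * e = a := by
  rw [Submodule.mem_span_singleton]
  constructor
  · rintro ⟨b, rfl⟩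
    rw [smul_eq_mul, mul_assoc, he]
  · exact fun h => ⟨a, h⟩

theorem projective_span_idempotent {e : A} (he : e * e = e) :
    Module.Projective A (Submodule.span A {e}) := by
  refine Module.Projective.of_split (Submodule.span A {e}).subtype
    ((LinearMap.toSpanSingleton A A e).codRestrict (Submodule.span A {e}) fun a =>
      Submodule.mem_span_singleton.2 ⟨a, rfl⟩) ?_
  ext ⟨a, ha⟩
  exact (mem_span_idempotent_iff he).1 ha

/-- The left ideal of `A` generated by an idempotent of degree `0` is graded. -/
theorem isGradedModule_span_idempotent {e : A} (he : e * e = e) (he0 : e ∈ 𝒜 0) (d : ℤ) :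
    IsGradedModule 𝒜 fun j => (extendByZero 𝒜 (j + -d)).comap
      (Submodule.span A {e}).subtype.toAddMonoidHom := by
  refine IsGradedModule.shift (ℳ := fun j => (extendByZero 𝒜 j).comap
      (Submodule.span A {e}).subtype.toAddMonoidHom)
    (isGradedModule_self.submodule (Submodule.span A {e}) fun j a ha => ?_) (-d)
  rw [mem_span_idempotent_iff he] at ha ⊢
  conv_rhs => rw [← ha]
  -- The left ideal is the set of fixed points of right multiplication by `e`, which has degree 0
  -- and so commutes with the projections.
  refine (IsGradedModule.map_proj_zero isGradedModule_self isGradedModule_self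
    (AddMonoidHom.mulRight e) ?_ j a).symm
  rintro (j | j) b hb
  · exact (add_zero j) ▸ SetLike.GradedMul.mul_mem (A := 𝒜) (i := j) (j := 0) hb he0
  · rw [AddSubgroup.mem_bot.1 hb, map_zero]
    exact zero_mem _

/-- Bounded below graded modules have graded projective covers. -/
theorem IsGradedModule.exists_projectiveCover [IsArtinianRing (𝒜 0)] (h : IsGradedModule 𝒜 ℳ)
    (hb : IsBoundedBelow ℳ) : ∃ (P : Type (max u v)) (_ : AddCommGroup P) (_ : Module A P)
      (𝒬 : ℤ → AddSubgroup P) (φ : P →ₗ[A] M), IsGradedModule 𝒜 𝒬 ∧ IsBoundedBelow 𝒬 ∧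
      Module.Projective A P ∧ (∀ j, ∀ x ∈ 𝒬 j, φ x ∈ ℳ j) ∧ Function.Surjective φ ∧
      LinearMap.ker φ ≤ gradedJacobson 𝒜 • (⊤ : Submodule A P) := by
  classical
  obtain ⟨ι, deg, x, e, hx, hx0, he0, he, hex, hea, hind, htop⟩ := h.exists_generators
  -- The cover is the direct sum of the `A e_i`, with `e_i` placed in degree `deg i` and sent to
  -- `x_i`.
  let X : ι → Submodule A A := fun i => Submodule.span A {e i}
  let 𝒳 : ∀ i, ℤ → AddSubgroup (X i) := fun i j =>
    (GradedKoszul.extendByZero 𝒜 (j + -deg i)).comap (X i).subtype.toAddMonoidHom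
  have h𝒳 : ∀ i, IsGradedModule 𝒜 (𝒳 i) := fun i =>
    isGradedModule_span_idempotent (he i) (he0 i) (deg i)
  have hproj : ∀ i, Module.Projective A (X i) := fun i => projective_span_idempotent (he i)
  let f : ∀ i, X i →ₗ[A] M := fun i => (LinearMap.toSpanSingleton A M (x i)).comp (X i).subtype
  let φ : (⨁ i, X i) →ₗ[A] M := DirectSum.toModule A ι M f
  have hφ : ∀ i (a : X i), φ (DirectSum.of (fun i => X i) i a) = (a : A) • x i := fun i a =>
    DirectSum.toModule_lof (M := fun i => X i) (φ := f) A i a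
  have hQ := IsGradedModule.directSum h𝒳
  have hdeg : ∀ i j, ∀ a ∈ 𝒳 i j, (a : A) • x i ∈ ℳ j := by
    intro i j a ha
    change (a : A) ∈ GradedKoszul.extendByZero 𝒜 (j + -deg i) at ha
    by_cases hj : j + -deg i < 0
    · rw [extendByZero_of_neg _ hj, AddSubgroup.mem_bot] at ha
      rw [ha, zero_smul]
      exact zero_mem _
    · obtain ⟨n, hn⟩ := Int.eq_ofNat_of_zero_le (not_lt.1 hj)
      rw [hn, extendByZero_natCast] at ha
      have := h.smul_mem n (deg i) _ ha _ (hx i)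
      rwa [show (n : ℤ) + deg i = j by omega] at this
  have hφdeg : ∀ j, ∀ y : ⨁ i, X i, (∀ i, y i ∈ 𝒳 i j) → φ y ∈ ℳ j := fun j y hy =>
    dfinsuppSumAddHom_mem (ℳ j) y (fun i => (f i).toAddMonoidHom) fun i _ => hdeg i j _ (hy i)
  have heX : ∀ i, e i ∈ X i := fun i => Submodule.mem_span_singleton_self _
  refine ⟨⨁ i, X i, inferInstance, inferInstance, _, φ, hQ, ?_, inferInstance, hφdeg, ?_, ?_⟩
  · obtain ⟨l, hl⟩ := hb
    refine ⟨l, fun j hj => (AddSubgroup.eq_bot_iff_forall _).2 fun y hy => ?_⟩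
    refine DFinsupp.ext fun i => Subtype.ext ?_
    -- Since `x i` is nonzero its degree is at least `l`, so the cover has the same lower bound as
    -- `M`.
    have hd : l ≤ deg i := by
      by_contra hlt
      have := hx i
      rw [hl _ (not_le.1 hlt)] at this
      exact hx0 i this
    have := hy i
    change ((y i : X i) : A) ∈ GradedKoszul.extendByZero 𝒜 (j + -deg i) at this
    rwa [extendByZero_of_neg _ (by omega), AddSubgroup.mem_bot] at this
  · rw [← LinearMap.range_eq_top]
    refine h.eq_top_of_sup_eq_top hb _ ?_ ?_
    · rintro j _ ⟨y, rfl⟩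
      exact ⟨_, (IsGradedModule.map_proj_zero hQ h φ.toAddMonoidHom hφdeg j y).symm⟩
    · have hle : ⊤ ≤ (LinearMap.range φ).map
          (Submodule.mkQ (gradedJacobson 𝒜 • (⊤ : Submodule A M))) := by
        refine htop.symm.le.trans (iSup_le fun i => ?_)
        have hxi : x i ∈ LinearMap.range φ :=
          ⟨DirectSum.of (fun i => X i) i ⟨e i, heX i⟩, (hφ i _).trans (hex i)⟩
        rw [Submodule.span_singleton_le_iff_mem]
        exact Submodule.mem_map_of_mem hxi
      rw [sup_comm, ← Submodule.comap_map_mkQ, top_le_iff.1 hle, Submodule.comap_top]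
  · intro y hy
    -- Modulo `JM` the submodules generated by the `x i` are independent. So for `y` in the kernel
    -- each `y i` annihilates the class of `x i`, whence `y i = y i * e i` lies in `J`.
    let S : ι → Submodule A (M ⧸ gradedJacobson 𝒜 • (⊤ : Submodule A M)) := fun i =>
      Submodule.span A {Submodule.mkQ (gradedJacobson 𝒜 • (⊤ : Submodule A M)) (x i)}
    let g : ∀ i, X i →ₗ[A] S i := fun i =>
      ((Submodule.mkQ (gradedJacobson 𝒜 • (⊤ : Submodule A M))).comp (f i)).codRestrict (S i)
        fun a => Submodule.mem_span_singleton.2 ⟨a, rfl⟩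
    have hcomp : (DFinsupp.lsum ℕ fun i => (S i).subtype).comp (DFinsupp.mapRange.linearMap g) =
        (Submodule.mkQ (gradedJacobson 𝒜 • (⊤ : Submodule A M))).comp φ := by
      refine DirectSum.linearMap_ext A fun i => LinearMap.ext fun a => ?_
      change (DFinsupp.lsum ℕ fun i => (S i).subtype)
        (DFinsupp.mapRange.linearMap g (DFinsupp.single i a)) = _
      rw [DFinsupp.mapRange.linearMap_apply, DFinsupp.mapRange_single, DFinsupp.lsum_single]
      exact congrArg _ (hφ i a).symm
    have h0 : DFinsupp.mapRange.linearMap g y = 0 := by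
      refine (injective_iff_map_eq_zero _).1 hind.dfinsupp_lsum_injective _ ?_
      refine (DFunLike.congr_fun hcomp y).trans ?_
      rw [LinearMap.comp_apply, LinearMap.mem_ker.1 hy, map_zero]
    have hyJ : ∀ i, ((y i : X i) : A) ∈ gradedJacobson 𝒜 := by
      intro i
      have h1 : g i (y i) = 0 := DFunLike.congr_fun h0 i
      have h2 : ((y i : X i) : A) • x i ∈ gradedJacobson 𝒜 • (⊤ : Submodule A M) :=
        (Submodule.Quotient.mk_eq_zero _).1 (congrArg Subtype.val h1)
      have h3 := hea i _ h2
      rwa [(mem_span_idempotent_iff (he i)).1 (y i).2] at h3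
    have hsum : DFinsupp.sumAddHom (DFinsupp.singleAddHom fun i => X i) y = y := by
      rw [DFinsupp.sumAddHom_singleAddHom]
      rfl
    rw [← hsum]
    refine dfinsuppSumAddHom_mem _ y _ fun i _ => ?_
    -- Writing `y i` as `y i` times the generator `e i` turns a coordinate in `J` into an element of
    -- `J P`.
    have : DFinsupp.singleAddHom (fun i => X i) i (y i) =
        ((y i : X i) : A) • DirectSum.lof A ι (fun i => X i) i ⟨e i, heX i⟩ := by
      rw [← map_smul]
      change DirectSum.lof A ι (fun i => X i) i (y i) = _
      congr 1
      exact Subtype.ext ((mem_span_idempotent_iff (he i)).1 (y i).2).symm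
    rw [this]
    exact Submodule.smul_mem_smul (hyJ i) trivial

end Radical

/-! ### Associated graded modules -/

section AssociatedGradedModules

variable {A : Type u} [Ring A] (I : Ideal A)
  {M : Type*} [AddCommGroup M] [Module A M] {N : Type*} [AddCommGroup N] [Module A N]
  {L : Type*} [AddCommGroup L] [Module A L]

theorem mem_adicModule_zero (x : M) : x ∈ adicModule M I 0 := by
  change x ∈ I ^ 0 • (⊤ : Submodule A M)
  rw [ideal_pow_zero_smul]
  trivial

theorem map_mem_adicModule (f : M →ₗ[A] N) {n : ℕ} {x : M} (hx : x ∈ adicModule M I n) :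
    f x ∈ adicModule N I n := by
  have h := Submodule.mem_map_of_mem (f := f) hx
  rw [adicModule, Submodule.map_smul''] at h
  exact Submodule.smul_mono le_rfl le_top h

/-- Surjections are strict for the adic filtrations. Both the surjectivity of `grMap` and the
lifting of classes to the true kernel rest on this. -/
theorem exists_mem_adicModule_of_surjective (f : M →ₗ[A] N) (hf : Function.Surjective f) {n : ℕ}
    {y : N} (hy : y ∈ adicModule N I n) : ∃ x ∈ adicModule M I n, f x = y := by
  have h : (adicModule M I n).map f = adicModule N I n := by
    rw [adicModule, Submodule.map_smul'', Submodule.map_top, LinearMap.range_eq_top.2 hf]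
    rfl
  rwa [← h] at hy

/-- The class of an element of `I^n M` in the component of degree `n` of `Gr_I M`. -/
def grMk (n : ℕ) : adicModule M I n →+ GrModule M I :=
  (GrModule.of M I n).comp (GrPiece.mk (adicModule M I) n)

theorem grMk_congr {m n : ℕ} (h : m = n) (x : adicModule M I m) (y : adicModule M I n)
    (hxy : x.1 = y.1) : grMk I m x = grMk I n y := by
  subst h
  rw [Subtype.ext hxy]

theorem grMk_eq_zero_iff {n : ℕ} {x : adicModule M I n} :
    grMk I n x = 0 ↔ x.1 ∈ adicModule M I (n + 1) := by
  constructor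
  · intro h
    have h1 : GrPiece.mk (adicModule M I) n x = 0 :=
      DirectSum.of_injective (β := GrPiece (adicModule M I)) n (h.trans (map_zero _).symm)
    exact (Submodule.Quotient.mk_eq_zero ((adicModule M I (n + 1)).comap _)).1 h1
  · intro h
    have h1 : GrPiece.mk (adicModule M I) n x = 0 := (Submodule.Quotient.mk_eq_zero _).2 h
    rw [grMk, AddMonoidHom.comp_apply, h1, map_zero]

theorem grMk_eq_grMk_iff {n : ℕ} {x y : adicModule M I n} :
    grMk I n x = grMk I n y ↔ x.1 - y.1 ∈ adicModule M I (n + 1) := by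
  rw [← sub_eq_zero, ← map_sub, grMk_eq_zero_iff]
  rfl

theorem mem_grModuleGrading_iff {n : ℕ} {y : GrModule M I} :
    y ∈ grModuleGrading M I (n : ℤ) ↔ ∃ x, grMk I n x = y := by
  constructor
  · rintro ⟨z, rfl⟩
    obtain ⟨x, rfl⟩ := GrPiece.mk_surjective _ _ z
    exact ⟨x, rfl⟩
  · rintro ⟨x, rfl⟩
    exact ⟨_, rfl⟩

theorem grMk_mem (n : ℕ) (x : adicModule M I n) : grMk I n x ∈ grModuleGrading M I (n : ℤ) :=
  (mem_grModuleGrading_iff I).2 ⟨x, rfl⟩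

@[elab_as_elim]
theorem grModule_induction {motive : GrModule M I → Prop} (y : GrModule M I)
    (mk : ∀ n x, motive (grMk I n x)) (add : ∀ y z, motive y → motive z → motive (y + z)) :
    motive y := by
  refine DirectSum.induction_on (motive := motive) y ?_ ?_ add
  · have := mk 0 0
    rwa [map_zero] at this
  · intro n z
    obtain ⟨x, rfl⟩ := GrPiece.mk_surjective _ _ z
    exact mk n x

variable [I.IsTwoSided]

/-- The class of an element of `I^n` in the component of degree `n` of `Gr_I A`. -/
def grRingMk (n : ℕ) : adicRing I n →+ Gr I :=
  (Gr.of I n).comp (GrPiece.mk (adicRing I) n)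

@[elab_as_elim]
theorem gr_induction {motive : Gr I → Prop} (y : Gr I)
    (mk : ∀ n x, motive (grRingMk I n x)) (add : ∀ y z, motive y → motive z → motive (y + z)) :
    motive y := by
  refine DirectSum.induction_on (motive := motive) y ?_ ?_ add
  · have := mk 0 0
    rwa [map_zero] at this
  · intro n z
    obtain ⟨x, rfl⟩ := GrPiece.mk_surjective _ _ z
    exact mk n x

theorem mem_grGrading_iff {n : ℕ} {y : Gr I} :
    y ∈ grGrading I n ↔ ∃ x, grRingMk I n x = y := by
  constructor
  · rintro ⟨z, rfl⟩
    obtain ⟨x, rfl⟩ := GrPiece.mk_surjective _ _ z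
    exact ⟨x, rfl⟩
  · rintro ⟨x, rfl⟩
    exact ⟨_, rfl⟩

theorem grRingMk_smul_grMk {i j : ℕ} (a : adicRing I i) (x : adicModule M I j) :
    grRingMk I i a • grMk I j x =
      grMk I (i + j) ⟨a.1 • x.1, adicModule_smul_mem I i j a.1 x.1 a.2 x.2⟩ :=
  DirectSum.Gmodule.of_smul_of (GrPiece (adicRing I)) (GrPiece (adicModule M I)) _ _

theorem isInternal_range_of {X : ℕ → Type*} [∀ n, AddCommGroup (X n)] :
    DirectSum.IsInternal fun n => (DirectSum.of X n).range := by
  refine isInternal_of_projections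
    (fun n => (DirectSum.of X n).comp (DFinsupp.evalAddMonoidHom n)) ?_ ?_ ?_
  · rintro n _ ⟨x, rfl⟩
    exact congrArg (DirectSum.of X n) (DirectSum.of_eq_same n x)
  · rintro m n hmn _ ⟨x, rfl⟩
    exact (congrArg (DirectSum.of X n) (DirectSum.of_eq_of_ne m n x hmn.symm)).trans (map_zero _)
  · intro y
    induction y using DirectSum.induction_on with
    | zero => exact zero_mem _
    | of n x => exact AddSubgroup.mem_iSup_of_mem n ⟨x, rfl⟩
    | add x y hx hy => exact add_mem hx hy

variable (M) in
theorem isGradedModule_grModule : IsGradedModule (grGrading I) (grModuleGrading M I) := by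
  refine .extendByZero (isInternal_range_of (X := GrPiece (adicModule M I))) ?_
  intro i j b hb y hy
  obtain ⟨a, rfl⟩ := (mem_grGrading_iff I).1 hb
  obtain ⟨x, rfl⟩ := (mem_grModuleGrading_iff (M := M) I).1 hy
  rw [grRingMk_smul_grMk]
  exact grMk_mem I _ _

-- `I^n M` is spanned by products `a • m` with `a ∈ I^n`, and such a product has class equal to the
-- class of `a` times the class of `m` in degree 0.
variable (M) in
theorem isGeneratedInDegree_grModule : IsGeneratedInDegree (Gr I) (grModuleGrading M I) 0 := by
  refine top_le_iff.1 fun y _ => ?_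
  induction y using grModule_induction with
  | mk n x =>
    refine Submodule.smul_induction_on' (I := I ^ n) (N := (⊤ : Submodule A M))
      (p := fun x hx => grMk I n ⟨x, hx⟩ ∈
        Submodule.span (Gr I) (grModuleGrading M I 0 : Set (GrModule M I))) x.2 ?_ ?_
    · intro a ha m _
      have h : grMk I n ⟨a • m, Submodule.smul_mem_smul ha trivial⟩ =
          grRingMk I n ⟨a, ha⟩ • grMk I 0 ⟨m, mem_adicModule_zero I m⟩ :=
        (grRingMk_smul_grMk I (i := n) (j := 0) ⟨a, ha⟩ ⟨m, mem_adicModule_zero I m⟩).symm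
      rw [h]
      exact Submodule.smul_mem _ _ (Submodule.subset_span (grMk_mem I 0 _))
    · intro x hx y hy ihx ihy
      have h : grMk I n ⟨x + y, add_mem hx hy⟩ = grMk I n ⟨x, hx⟩ + grMk I n ⟨y, hy⟩ :=
        map_add (grMk I n) ⟨x, hx⟩ ⟨y, hy⟩
      rw [h]
      exact add_mem ihx ihy
  | add y z hy hz => exact add_mem (hy trivial) (hz trivial)

/-- The homomorphism of degree `s` between associated graded modules that is induced by a
homomorphism `f` with `f (I^n M) ⊆ I^(n+s) N`. -/
def grMapShift (f : M →ₗ[A] N) (s : ℕ)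
    (hf : ∀ n, ∀ x ∈ adicModule M I n, f x ∈ adicModule N I (n + s)) :
    GrModule M I →ₗ[Gr I] GrModule N I :=
  let p : ∀ n, GrPiece (adicModule M I) n →+ GrPiece (adicModule N I) (n + s) := fun n =>
    (Submodule.mapQ ((adicModule M I (n + 1)).comap (adicModule M I n).subtype)
      ((adicModule N I (n + s + 1)).comap (adicModule N I (n + s)).subtype)
      (f.restrict (hf n)) fun x hx => by
        have := hf (n + 1) x.1 hx
        rwa [show n + 1 + s = n + s + 1 by omega] at this).toAddMonoidHom
  let F : GrModule M I →+ GrModule N I :=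
    DirectSum.toAddMonoid fun n => (GrModule.of N I (n + s)).comp (p n)
  have hF : ∀ n x, F (grMk I n x) = grMk I (n + s) ⟨f x.1, hf n x.1 x.2⟩ := fun n x =>
    DirectSum.toAddMonoid_of (β := GrPiece (adicModule M I)) _ n _
  { F with
    map_smul' := fun b y => by
      change F (b • y) = b • F y
      induction b using gr_induction with
      | mk i a =>
        induction y using grModule_induction with
        | mk j x =>
          rw [grRingMk_smul_grMk, hF, hF, grRingMk_smul_grMk]
          exact grMk_congr I (add_assoc i j s) _ _ (map_smul f a.1 x.1)
        | add y z hy hz => rw [smul_add, map_add, hy, hz, map_add, smul_add]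
      | add b c hb hc => rw [add_smul, map_add, hb, hc, add_smul] }

theorem grMapShift_grMk (f : M →ₗ[A] N) (s : ℕ)
    (hf : ∀ n, ∀ x ∈ adicModule M I n, f x ∈ adicModule N I (n + s)) (n : ℕ)
    (x : adicModule M I n) :
    grMapShift I f s hf (grMk I n x) = grMk I (n + s) ⟨f x.1, hf n x.1 x.2⟩ :=
  DirectSum.toAddMonoid_of (β := GrPiece (adicModule M I)) _ n _

theorem grMapShift_mem (f : M →ₗ[A] N) (s : ℕ)
    (hf : ∀ n, ∀ x ∈ adicModule M I n, f x ∈ adicModule N I (n + s)) (j : ℤ)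
    (y : GrModule M I) (hy : y ∈ grModuleGrading M I j) :
    grMapShift I f s hf y ∈ grModuleGrading N I (j + s) := by
  rcases j with n | n
  · obtain ⟨x, rfl⟩ := (mem_grModuleGrading_iff I).1 hy
    rw [grMapShift_grMk]
    exact grMk_mem I (n + s) _
  · rw [AddSubgroup.mem_bot.1 hy, map_zero]
    exact zero_mem _

/-- The homomorphism of associated graded modules induced by a homomorphism. -/
def grMap (f : M →ₗ[A] N) : GrModule M I →ₗ[Gr I] GrModule N I :=
  grMapShift I f 0 fun _ _ hx => map_mem_adicModule I f hx

theorem grMap_grMk (f : M →ₗ[A] N) (n : ℕ) (x : adicModule M I n) :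
    grMap I f (grMk I n x) = grMk I n ⟨f x.1, map_mem_adicModule I f x.2⟩ :=
  grMapShift_grMk I f 0 _ n x

theorem grMap_mem (f : M →ₗ[A] N) (j : ℤ) (y : GrModule M I) (hy : y ∈ grModuleGrading M I j) :
    grMap I f y ∈ grModuleGrading N I j := by
  have := grMapShift_mem I f 0 (fun _ _ hx => map_mem_adicModule I f hx) j y hy
  rwa [Nat.cast_zero, add_zero] at this

theorem grMap_comp (g : N →ₗ[A] L) (f : M →ₗ[A] N) (y : GrModule M I) :
    grMap I g (grMap I f y) = grMap I (g.comp f) y := by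
  induction y using grModule_induction with
  | mk n x =>
    rw [grMap_grMk, grMap_grMk, grMap_grMk]
    rfl
  | add y z hy hz => simp only [map_add, hy, hz]

theorem grMap_id (y : GrModule M I) : grMap I LinearMap.id y = y := by
  induction y using grModule_induction with
  | mk n x =>
    rw [grMap_grMk]
    rfl
  | add y z hy hz => rw [map_add, hy, hz]

theorem grMap_surjective (f : M →ₗ[A] N) (hf : Function.Surjective f) :
    Function.Surjective (grMap I f) := by
  intro y
  induction y using grModule_induction with
  | mk n y =>
    obtain ⟨x, hx, hxy⟩ := exists_mem_adicModule_of_surjective I f hf y.2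
    refine ⟨grMk I n ⟨x, hx⟩, ?_⟩
    rw [grMap_grMk]
    exact grMk_congr I rfl _ _ hxy
  | add y z hy hz =>
    obtain ⟨y', rfl⟩ := hy
    obtain ⟨z', rfl⟩ := hz
    exact ⟨y' + z', map_add _ _ _⟩

/-- A class in `Gr_I M` that vanishes in `Gr_I N` is the class of an element of the kernel. -/
theorem exists_mem_ker_of_grMap_eq_zero (f : M →ₗ[A] N) (hf : Function.Surjective f) (n : ℕ)
    (x : adicModule M I n) (hx : grMap I f (grMk I n x) = 0) :
    ∃ y : adicModule M I n, f y.1 = 0 ∧ grMk I n y = grMk I n x := by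
  rw [grMap_grMk, grMk_eq_zero_iff] at hx
  obtain ⟨z, hz, hzx⟩ := exists_mem_adicModule_of_surjective I f hf hx
  have hz' : z ∈ adicModule M I n := ideal_pow_smul_le I (Nat.le_succ n) _ hz
  refine ⟨x - ⟨z, hz'⟩, ?_, ?_⟩
  · change f (x.1 - z) = 0
    rw [map_sub, hzx, sub_self]
  · rw [map_sub, (grMk_eq_zero_iff I (x := ⟨z, hz'⟩)).2 hz, sub_zero]

/-! ### Associated graded modules of projective modules -/

theorem mem_ideal_pow_of_mem_adicModule {n : ℕ} {a : A} (ha : a ∈ adicModule A I n) :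
    a ∈ adicRing I n := by
  have h : I ^ n • (⊤ : Submodule A A) ≤ I ^ n :=
    Submodule.smul_le.2 fun b hb c _ => (I ^ n).mul_mem_right c hb
  exact h ha

/-- An element of `Gr_I A` is determined by its action on the class of `1`. -/
theorem gr_smul_one_injective : Function.Injective fun b : Gr I =>
    b • grMk (M := A) I 0 ⟨1, mem_adicModule_zero I 1⟩ := by
  let ψ : GrModule A I →+ Gr I := DirectSum.toAddMonoid fun n => (Gr.of I n).comp
    (Submodule.mapQ ((adicModule A I (n + 1)).comap (adicModule A I n).subtype)
      ((adicRing I (n + 1)).comap (adicRing I n).subtype)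
      (Submodule.inclusion fun _ hx => mem_ideal_pow_of_mem_adicModule I hx) fun x hx =>
        mem_ideal_pow_of_mem_adicModule I (a := x.1) hx).toAddMonoidHom
  have hψ : ∀ n x, ψ (grMk I n x) = grRingMk I n ⟨x.1, mem_ideal_pow_of_mem_adicModule I x.2⟩ :=
    fun n x => DirectSum.toAddMonoid_of (β := GrPiece (adicModule A I)) _ n _
  refine Function.LeftInverse.injective (g := ψ) fun b => ?_
  induction b using gr_induction with
  | mk n a =>
    rw [grRingMk_smul_grMk, hψ]
    exact congrArg (grRingMk I n) (Subtype.ext (mul_one a.1))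
  | add b c hb hc => rw [add_smul, map_add, hb, hc]

/-- The associated graded module of a free module is free on the classes of the basis vectors, all
in degree 0. Independence is seen in coordinates; generation follows from generation in degree 0. -/
theorem projective_grModule_finsupp (ι : Type*) :
    Module.Projective (Gr I) (GrModule (ι →₀ A) I) := by
  classical
  let π : (ι →₀ Gr I) →ₗ[Gr I] GrModule (ι →₀ A) I := Finsupp.linearCombination (Gr I)
    fun i => grMk I 0 ⟨Finsupp.single i 1, mem_adicModule_zero I _⟩
  have hinj : Function.Injective π := by
    rw [injective_iff_map_eq_zero]
    intro y hy
    have hcoord : ∀ i, ∀ y : ι →₀ Gr I, grMap I (Finsupp.lapply i) (π y) =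
        y i • grMk (M := A) I 0 ⟨1, mem_adicModule_zero I 1⟩ := by
      intro i y
      induction y using Finsupp.induction_linear with
      | zero => simp
      | add y z hy hz => rw [map_add, map_add, hy, hz, Finsupp.add_apply, add_smul]
      | single k b =>
        rw [Finsupp.linearCombination_single, map_smul, grMap_grMk]
        by_cases hk : k = i
        · subst hk
          rw [Finsupp.single_eq_same]
          congr 1
          exact grMk_congr I rfl _ _ (by simp)
        · rw [Finsupp.single_eq_of_ne (Ne.symm hk), zero_smul]
          have h0 : (⟨(Finsupp.lapply i : (ι →₀ A) →ₗ[A] A) (Finsupp.single k 1),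
              map_mem_adicModule I _ (mem_adicModule_zero I _)⟩ : adicModule A I 0) = 0 := by
            refine Subtype.ext ?_
            simp [Finsupp.single_eq_of_ne (Ne.symm hk)]
          rw [h0, map_zero, smul_zero]
    refine Finsupp.ext fun i => gr_smul_one_injective I ?_
    change y i • _ = (0 : Gr I) • _
    rw [← hcoord, hy, map_zero, zero_smul]
  have hsurj : Function.Surjective π := by
    rw [← LinearMap.range_eq_top, ← top_le_iff, ← isGeneratedInDegree_grModule I (ι →₀ A),
      Submodule.span_le]
    let c : (ι →₀ A) →+ GrModule (ι →₀ A) I := (grMk I 0).comp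
      ((AddMonoidHom.id (ι →₀ A)).codRestrict (adicModule (ι →₀ A) I 0) (mem_adicModule_zero I))
    have hc : ∀ x, c x ∈ LinearMap.range π := by
      intro x
      induction x using Finsupp.induction_linear with
      | zero => rw [map_zero]; exact zero_mem _
      | add x y hx hy => rw [map_add]; exact add_mem hx hy
      | single i a =>
        have ha : a ∈ adicRing I 0 := by
          change a ∈ I ^ 0
          rw [Submodule.pow_zero, Ideal.one_eq_top]
          trivial
        refine ⟨Finsupp.single i (grRingMk I 0 ⟨a, ha⟩), ?_⟩
        rw [Finsupp.linearCombination_single, grRingMk_smul_grMk]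
        exact grMk_congr I rfl _ _ (by simp)
    intro y hy
    obtain ⟨x, rfl⟩ := (mem_grModuleGrading_iff (n := 0) I).1 hy
    exact hc x.1
  exact Module.Projective.of_equiv (LinearEquiv.ofBijective π ⟨hinj, hsurj⟩)

-- Functoriality of `grMap` carries over the splitting that makes `M` a direct summand of a free
-- module.
variable (M) in
theorem projective_grModule [Module.Projective A M] : Module.Projective (Gr I) (GrModule M I) := by
  obtain ⟨s, hs⟩ := Module.Projective.out (R := A) (P := M)
  have := projective_grModule_finsupp I M
  refine Module.Projective.of_split (grMap I s)
    (grMap I (Finsupp.linearCombination A (id : M → M))) (LinearMap.ext fun y => ?_)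
  rw [LinearMap.comp_apply, grMap_comp, show (Finsupp.linearCombination A (id : M → M)).comp s =
    LinearMap.id from LinearMap.ext hs, grMap_id]
  rfl

end AssociatedGradedModules

/-! ### Linear resolutions of associated graded modules -/

section LinearResolutions

/-- Two projective covers that are generated in the same degree are isomorphic. -/
theorem IsGradedModule.exists_bijective_lift {B : Type*} [Ring B] {ℬ : ℕ → AddSubgroup B}
    [GradedRing ℬ] {P Q N : Type*} [AddCommGroup P] [Module B P] [AddCommGroup Q] [Module B Q]
    [AddCommGroup N] [Module B N] {𝒬 : ℤ → AddSubgroup Q} {𝒳 : ℤ → AddSubgroup P}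
    {𝒩 : ℤ → AddSubgroup N} (hQ : IsGradedModule ℬ 𝒬) (hP : IsGradedModule ℬ 𝒳)
    (hN : IsGradedModule ℬ 𝒩) [Module.Projective B Q] [Module.Projective B P] {d : ℤ}
    (hQd : IsGeneratedInDegree B 𝒬 d) (hPd : IsGeneratedInDegree B 𝒳 d)
    (π : Q →ₗ[B] N) (ρ : P →ₗ[B] N) (hπ : ∀ j, ∀ x ∈ 𝒬 j, π x ∈ 𝒩 j)
    (hρ : ∀ j, ∀ x ∈ 𝒳 j, ρ x ∈ 𝒩 j) (hπs : Function.Surjective π) (hρs : Function.Surjective ρ)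
    (hπi : ∀ x ∈ 𝒬 d, π x = 0 → x = 0) (hρi : ∀ x ∈ 𝒳 d, ρ x = 0 → x = 0) :
    ∃ g : Q →ₗ[B] P, Function.Bijective g ∧ (∀ j, ∀ x ∈ 𝒬 j, g x ∈ 𝒳 j) ∧
      ∀ x, ρ (g x) = π x := by
  obtain ⟨g, hg, hgπ⟩ := hQ.exists_lift hP hN ρ hρ hρs π hπ
  obtain ⟨k, hk, hkρ⟩ := hP.exists_lift hQ hN π hπ hπs ρ hρ
  -- On generators, `k ∘ g - id` takes values in the kernel of `π` in degree `d`, which is zero.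
  have h1 : k.comp g = LinearMap.id := hQd.linearMap_ext fun x hx => by
    rw [← sub_eq_zero]
    refine hπi _ (sub_mem (hk d _ (hg d x hx)) hx) ?_
    rw [map_sub, LinearMap.comp_apply, hkρ, hgπ, LinearMap.id_apply, sub_self]
  have h2 : g.comp k = LinearMap.id := hPd.linearMap_ext fun x hx => by
    rw [← sub_eq_zero]
    refine hρi _ (sub_mem (hg d _ (hk d x hx)) hx) ?_
    rw [map_sub, LinearMap.comp_apply, hgπ, hkρ, LinearMap.id_apply, sub_self]
  exact ⟨g, Function.bijective_iff_has_inverse.2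
    ⟨k, DFunLike.congr_fun h1, DFunLike.congr_fun h2⟩, hg, hgπ⟩

variable {A : Type u} [Ring A] (I : Ideal A) [I.IsTwoSided]
  {M : Type v} [AddCommGroup M] [Module A M] {P : Type w} [AddCommGroup P] [Module A P]

/-- If `P → M` is a projective cover, then the first syzygy in a linear resolution of `Gr_I M` is
the kernel of `Gr_I P → Gr_I M`. -/
theorem exists_linear_presentation_of_isLinear
    (R : GradedProjectiveResolution (grGrading I) (grModuleGrading M I)) (hR : R.IsLinear)
    [Module.Projective A P] (φ : P →ₗ[A] M) (hφ : Function.Surjective φ)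
    (hker : LinearMap.ker φ ≤ I • (⊤ : Submodule A P)) :
    ∃ f : R.P 1 →ₗ[Gr I] GrModule P I, (∀ j, ∀ x ∈ R.grading 1 j, f x ∈ grModuleGrading P I j) ∧
      LinearMap.range f = LinearMap.ker (grMap I φ) ∧ Function.Exact (R.d 1) f := by
  have := R.projective 0
  have := projective_grModule I P
  have hP := isGradedModule_grModule I P
  have hM := isGradedModule_grModule I M
  -- The kernel of the augmentation is the image of `R.P 1`, which starts in degree 1.
  have hεi : ∀ x ∈ R.grading 0 0, R.ε x = 0 → x = 0 := by
    intro x hx hx0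
    obtain ⟨y, rfl⟩ := (R.exact_zero x).1 hx0
    rw [← (R.isGraded 0).proj_self hx]
    have h := IsGradedModule.map_proj_zero (R.isGraded 1) (R.isGraded 0) (R.d 0).toAddMonoidHom
      (R.d_mem 0) 0 y
    refine h.trans ?_
    have h0 : gradedProj (R.isGraded 1).isInternal 0 y = 0 :=
      (R.isGraded 1).eq_bot_of_generated (hR 1) (j := 0) (by norm_num)
        ((R.isGraded 1).proj_mem 0 y)
    rw [h0, map_zero]
  -- A class of degree 0 in the kernel is represented by an element of `Ker φ ⊆ I P`, and so it
  -- vanishes.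
  have hφi : ∀ x ∈ grModuleGrading P I 0, grMap I φ x = 0 → x = 0 := by
    intro x hx hx0
    obtain ⟨y, rfl⟩ := (mem_grModuleGrading_iff (n := 0) I).1 hx
    obtain ⟨z, hz, hzy⟩ := exists_mem_ker_of_grMap_eq_zero I φ hφ 0 y hx0
    rw [← hzy, grMk_eq_zero_iff]
    change z.1 ∈ I ^ 1 • (⊤ : Submodule A P)
    rw [Submodule.pow_one]
    exact hker hz
  obtain ⟨g, hg, hgdeg, hgε⟩ := IsGradedModule.exists_bijective_lift (R.isGraded 0) hP hM (d := 0)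
    (hR 0) (isGeneratedInDegree_grModule I P) R.ε (grMap I φ) R.ε_mem (grMap_mem I φ)
    R.ε_surjective (grMap_surjective I φ hφ) hεi hφi
  refine ⟨g.comp (R.d 0), fun j x hx => hgdeg j _ (R.d_mem 0 j x hx), ?_, fun x => ?_⟩
  · ext y
    constructor
    · rintro ⟨x, rfl⟩
      rw [LinearMap.mem_ker, LinearMap.comp_apply, hgε]
      exact R.exact_zero.apply_apply_eq_zero x
    · intro hy
      obtain ⟨z, rfl⟩ := hg.2 y
      rw [LinearMap.mem_ker, hgε] at hy
      obtain ⟨x, rfl⟩ := (R.exact_zero z).1 hy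
      exact ⟨x, rfl⟩
  · rw [LinearMap.comp_apply, ← (R.exact_succ 0 x)]
    exact map_eq_zero_iff g hg.1

theorem pow_smul_le_adicModule_succ {K : Submodule A P} (hK : K ≤ I • (⊤ : Submodule A P))
    (n : ℕ) : I ^ n • K ≤ adicModule P I (n + 1) := by
  refine (Submodule.smul_mono le_rfl hK).trans (le_of_eq ?_)
  have h := ideal_pow_add_smul I n 1 (⊤ : Submodule A P)
  rw [Submodule.pow_one] at h
  exact h.symm

/-- The class of `x` in degree `n + 1` lies in the kernel of `grMap I φ`, which is generated in
degree 1. It is thus a sum of products of classes from `I^n` with kernel classes of degree 1.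
Lifting the latter to `Ker φ` approximates `x` by an element of `I^n Ker φ` up to the next
filtration step. -/
theorem ker_inf_pow_smul_le_of_isLinear
    (R : GradedProjectiveResolution (grGrading I) (grModuleGrading M I)) (hR : R.IsLinear)
    [Module.Projective A P] (φ : P →ₗ[A] M) (hφ : Function.Surjective φ)
    (hker : LinearMap.ker φ ≤ I • (⊤ : Submodule A P)) (n : ℕ) :
    LinearMap.ker φ ⊓ I ^ (n + 1) • (⊤ : Submodule A P) ≤
      I ^ n • LinearMap.ker φ ⊔ I ^ (n + 2) • (⊤ : Submodule A P) := by
  obtain ⟨f, hf, hrange, -⟩ := exists_linear_presentation_of_isLinear I R hR φ hφ hker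
  have hadic := pow_smul_le_adicModule_succ I hker
  rintro x ⟨hxK, hxI⟩
  have hx0 : grMk I (n + 1) ⟨x, hxI⟩ ∈ LinearMap.ker (grMap I φ) := by
    rw [LinearMap.mem_ker, grMap_grMk, grMk_eq_zero_iff]
    change φ x ∈ _
    rw [LinearMap.mem_ker.1 hxK]
    exact zero_mem _
  rw [← hrange] at hx0
  obtain ⟨q, hq⟩ := hx0
  have key : ∀ q ∈ R.grading 1 ((n + 1 : ℕ) : ℤ), ∃ k, ∃ hk : k ∈ I ^ n • LinearMap.ker φ,
      f q = grMk I (n + 1) ⟨k, hadic n hk⟩ := by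
    intro q hq
    have hq' := (R.isGraded 1).mem_closure_of_generated (hR 1) hq
    clear hq
    induction hq' using AddSubgroup.closure_induction with
    | mem q hq =>
      obtain ⟨i, hi, b, hb, m, hm, rfl⟩ := hq
      obtain rfl : i = n := by
        push_cast at hi
        omega
      obtain ⟨a, rfl⟩ := (mem_grGrading_iff I).1 hb
      obtain ⟨y, hy⟩ := (mem_grModuleGrading_iff I).1 (hf _ m hm)
      have hy0 : grMap I φ (grMk I 1 y) = 0 := by
        rw [hy, ← LinearMap.mem_ker, ← hrange]
        exact ⟨m, rfl⟩
      -- The generator of degree 1 is represented by an element of the actual kernel of `φ`.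
      obtain ⟨k, hk0, hk⟩ := exists_mem_ker_of_grMap_eq_zero I φ hφ 1 y hy0
      refine ⟨a.1 • k.1, Submodule.smul_mem_smul a.2 hk0, ?_⟩
      rw [map_smul, ← hy, ← hk, grRingMk_smul_grMk]
    | zero =>
      refine ⟨0, zero_mem _, ?_⟩
      rw [map_zero]
      exact (map_zero (grMk I (n + 1))).symm
    | add p q _ _ hp hq =>
      obtain ⟨k, hk, hkp⟩ := hp
      obtain ⟨l, hl, hlq⟩ := hq
      refine ⟨k + l, add_mem hk hl, ?_⟩
      rw [map_add, hkp, hlq, ← map_add]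
      rfl
    | neg q _ hq =>
      obtain ⟨k, hk, hkq⟩ := hq
      refine ⟨-k, neg_mem hk, ?_⟩
      rw [map_neg, hkq, ← map_neg]
      rfl
  -- Since `f` has degree 0 and its target value is homogeneous, `q` may be replaced by its
  -- component of degree `n + 1`.
  obtain ⟨k, hk, hkq⟩ := key _ ((R.isGraded 1).proj_mem ((n + 1 : ℕ) : ℤ) q)
  have h1 := IsGradedModule.map_proj_zero (R.isGraded 1) (isGradedModule_grModule I P)
    f.toAddMonoidHom hf ((n + 1 : ℕ) : ℤ) q
  have h2 : f.toAddMonoidHom q = grMk I (n + 1) ⟨x, hxI⟩ := hq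
  rw [h2, (isGradedModule_grModule I P).proj_self (grMk_mem I (n + 1) _)] at h1
  have h3 := h1.trans hkq
  rw [grMk_eq_grMk_iff] at h3
  have h4 : x = k + (x - k) := by abel
  rw [h4]
  exact Submodule.add_mem_sup hk h3

/-- The associated graded module of the kernel of a projective cover of `M` inherits a linear
resolution from that of `M`. -/
theorem exists_isLinear_ker
    (R : GradedProjectiveResolution (grGrading I) (grModuleGrading M I)) (hR : R.IsLinear)
    {P : Type (max u v)} [AddCommGroup P] [Module A P]
    [Module.Projective A P] (φ : P →ₗ[A] M) (hφ : Function.Surjective φ)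
    (hker : ∀ n : ℕ, I ^ n • LinearMap.ker φ =
      LinearMap.ker φ ⊓ I ^ (n + 1) • (⊤ : Submodule A P)) :
    ∃ R' : GradedProjectiveResolution (grGrading I) (grModuleGrading (LinearMap.ker φ) I),
      R'.IsLinear := by
  have hker0 : LinearMap.ker φ ≤ I • (⊤ : Submodule A P) := by
    have h := hker 0
    rw [ideal_pow_zero_smul, zero_add, Submodule.pow_one] at h
    exact h.le.trans inf_le_right
  obtain ⟨f, hf, hrange, hexact⟩ := exists_linear_presentation_of_isLinear I R hR φ hφ hker0
  set K := LinearMap.ker φ with hK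
  have hsub : ∀ n (x : K), x ∈ adicModule K I n ↔ x.1 ∈ I ^ n • K := by
    intro n x
    have h : (adicModule K I n).map K.subtype = I ^ n • K := by
      rw [adicModule, Submodule.map_smul'', Submodule.map_top, Submodule.range_subtype]
    rw [← h]
    refine ⟨Submodule.mem_map_of_mem, ?_⟩
    rintro ⟨y, hy, hyx⟩
    rwa [← Subtype.ext hyx]
  -- As `K ⊆ I P`, the inclusion raises the filtration by one and induces a map of degree 1, not 0.
  let ι : GrModule K I →ₗ[Gr I] GrModule P I := grMapShift I K.subtype 1 fun n x hx =>
    pow_smul_le_adicModule_succ I hker0 n ((hsub n x).1 hx)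
  have hGK := isGradedModule_grModule I K
  have hGP := isGradedModule_grModule I P
  have hGM := isGradedModule_grModule I M
  have hιdeg : ∀ j, ∀ y ∈ grModuleGrading K I j, ι y ∈ grModuleGrading P I (j + 1) :=
    grMapShift_mem I K.subtype 1 _
  have hιmk : ∀ n x, ι (grMk I n x) = grMk I (n + 1) ⟨x.1.1,
      pow_smul_le_adicModule_succ I hker0 n ((hsub n x.1).1 x.2)⟩ :=
    grMapShift_grMk I K.subtype 1 _
  -- Injectivity is the inclusion `K ∩ I^(n+2) P ⊆ I^(n+1) K`: a class killed in `Gr_I P` is already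
  -- zero in `Gr_I K`.
  have hιinj : Function.Injective ι := by
    rw [injective_iff_map_eq_zero]
    intro y hy
    refine hGK.ext_proj fun j => ?_
    have h1 := IsGradedModule.map_proj hGK hGP ι.toAddMonoidHom hιdeg j y
    have h2 : ι.toAddMonoidHom y = 0 := hy
    rw [h2, map_zero] at h1
    rw [map_zero]
    have h3 : ι (gradedProj hGK.isInternal j y) = 0 := h1.symm
    have h4 := hGK.proj_mem j y
    generalize gradedProj hGK.isInternal j y = z at h3 h4
    rcases j with n | n
    · obtain ⟨x, rfl⟩ := (mem_grModuleGrading_iff I).1 h4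
      rw [hιmk, grMk_eq_zero_iff] at h3
      rw [grMk_eq_zero_iff, hsub, hker]
      exact ⟨x.1.2, h3⟩
    · exact AddSubgroup.mem_bot.1 h4
  have hιrange : LinearMap.range ι = LinearMap.ker (grMap I φ) := by
    ext z
    constructor
    · rintro ⟨y, rfl⟩
      rw [LinearMap.mem_ker]
      induction y using grModule_induction with
      | mk n x =>
        rw [hιmk, grMap_grMk, grMk_eq_zero_iff]
        change φ x.1.1 ∈ _
        rw [LinearMap.mem_ker.1 x.1.2]
        exact zero_mem _
      | add y z hy hz => rw [map_add, map_add, hy, hz, add_zero]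
    · intro hz
      refine hGP.mem_of_proj_mem (LinearMap.range ι).toAddSubgroup fun j => ?_
      have h1 := IsGradedModule.map_proj_zero hGP hGM (grMap I φ).toAddMonoidHom
        (grMap_mem I φ) j z
      have h2 : (grMap I φ).toAddMonoidHom z = 0 := hz
      rw [h2, map_zero] at h1
      have h3 : grMap I φ (gradedProj hGP.isInternal j z) = 0 := h1.symm
      have h4 := hGP.proj_mem j z
      generalize gradedProj hGP.isInternal j z = y at h3 h4
      rcases j with n | n
      · obtain ⟨x, rfl⟩ := (mem_grModuleGrading_iff I).1 h4
        obtain ⟨k, hk, hkx⟩ := exists_mem_ker_of_grMap_eq_zero I φ hφ n x h3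
        rw [← hkx]
        cases n with
        -- In degree 0 the kernel of `grMap I φ` is zero, which is why the shift by one loses
        -- nothing.
        | zero =>
          have h0 : grMk I 0 k = 0 := by
            rw [grMk_eq_zero_iff]
            change k.1 ∈ I ^ 1 • (⊤ : Submodule A P)
            rw [Submodule.pow_one]
            exact hker0 hk
          rw [h0]
          exact zero_mem _
        | succ m =>
          have hkm : (⟨k.1, hk⟩ : K) ∈ adicModule K I m := by
            rw [hsub, hker]
            exact ⟨hk, k.2⟩
          exact ⟨grMk I m ⟨⟨k.1, hk⟩, hkm⟩, hιmk m _⟩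
      · rw [AddSubgroup.mem_bot.1 h4]
        exact zero_mem _
  let e := LinearEquiv.ofInjective ι hιinj
  let ε : R.P 1 →ₗ[Gr I] GrModule K I := e.symm.toLinearMap.comp
    (f.codRestrict (LinearMap.range ι) fun x => by
      rw [hιrange, ← hrange]
      exact ⟨x, rfl⟩)
  have hιε : ∀ x, ι (ε x) = f x := fun x =>
    congrArg Subtype.val (e.apply_symm_apply (f.codRestrict (LinearMap.range ι) _ x))
  -- The tail of `R`, with degrees lowered by one: `R.P (n + 1)`, generated in degree `n + 1`,
  -- becomes the term `n`, generated in degree `n`.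
  refine ⟨{ P := fun n => R.P (n + 1)
            grading := fun n j => R.grading (n + 1) (j + 1)
            isGraded := fun n => (R.isGraded (n + 1)).shift 1
            projective := fun n => R.projective (n + 1)
            ε := ε
            d := fun n => R.d (n + 1)
            ε_mem := ?_
            d_mem := fun n j x hx => R.d_mem (n + 1) (j + 1) x hx
            ε_surjective := ?_
            exact_zero := ?_
            exact_succ := fun n => R.exact_succ (n + 1) }, fun n => ?_⟩
  · intro j x hx
    rw [hGK.mem_iff_proj_eq]
    intro i hij
    refine (injective_iff_map_eq_zero ι).1 hιinj _ ?_
    have h1 := IsGradedModule.map_proj hGK hGP ι.toAddMonoidHom hιdeg i (ε x)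
    refine h1.symm.trans ?_
    have h2 : ι.toAddMonoidHom (ε x) = f x := hιε x
    rw [h2]
    exact hGP.proj_of_ne (by omega) (hf _ x hx)
  · intro y
    have h1 : ι y ∈ LinearMap.range f := by
      rw [hrange, ← hιrange]
      exact ⟨y, rfl⟩
    obtain ⟨x, hx⟩ := h1
    exact ⟨x, hιinj ((hιε x).trans hx)⟩
  · intro x
    rw [← hexact x, ← hιε x]
    exact (map_eq_zero_iff ι hιinj).symm
  · have h := hR (n + 1)
    rwa [Nat.cast_succ] at h

end LinearResolutions

/-! ### The minimal resolution -/

section MinimalResolution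

variable {A : Type u} [Ring A] {𝒜 : ℕ → AddSubgroup A}
  {M : Type v} [AddCommGroup M] [Module A M] {ℳ : ℤ → AddSubgroup M}

/-- The grading of a submodule by its intersections with the components. -/
def submoduleGrading (ℳ : ℤ → AddSubgroup M) (K : Submodule A M) : ℤ → AddSubgroup K :=
  fun j => (ℳ j).comap K.subtype.toAddMonoidHom

variable [GradedRing 𝒜]

variable (𝒜 M) in
/-- `Gr_J M` has a linear resolution over `Gr_J A`. -/
def HasLinearGrResolution : Prop :=
  ∃ R : GradedProjectiveResolution (grGrading (gradedJacobson 𝒜))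
    (grModuleGrading M (gradedJacobson 𝒜)), R.IsLinear

/-- A graded projective cover `φ` of `M` such that `J^k Ker φ = Ker φ ∩ J^(k+1) P` and such that
the associated graded module of the kernel has a linear resolution. -/
structure LinearCover (𝒜 : ℕ → AddSubgroup A) [GradedRing 𝒜] (ℳ : ℤ → AddSubgroup M) where
  P : Type (max u v)
  [addCommGroup : AddCommGroup P]
  [module : Module A P]
  grading : ℤ → AddSubgroup P
  φ : P →ₗ[A] M
  isGraded : IsGradedModule 𝒜 grading
  projective : Module.Projective A P
  φ_mem : ∀ j, ∀ x ∈ grading j, φ x ∈ ℳ j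
  φ_surjective : Function.Surjective φ
  pow_smul_ker : ∀ k : ℕ, gradedJacobson 𝒜 ^ k • LinearMap.ker φ =
    LinearMap.ker φ ⊓ gradedJacobson 𝒜 ^ (k + 1) • (⊤ : Submodule A P)
  isGraded_ker : IsGradedModule 𝒜 (submoduleGrading grading (LinearMap.ker φ))
  isBoundedBelow_ker : IsBoundedBelow (submoduleGrading grading (LinearMap.ker φ))
  hasLinearGrResolution_ker : HasLinearGrResolution 𝒜 (LinearMap.ker φ)

attribute [instance] LinearCover.addCommGroup LinearCover.module

/-- The inductive step of the construction. All hypotheses on `M` are passed on to the kernel of the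
cover, so the step can be repeated. -/
theorem nonempty_linearCover [IsArtinianRing (𝒜 0)] (h : IsGradedModule 𝒜 ℳ)
    (hb : IsBoundedBelow ℳ) (hlin : HasLinearGrResolution 𝒜 M) :
    Nonempty (LinearCover 𝒜 ℳ) := by
  obtain ⟨P, _, _, 𝒬, φ, hQ, hQb, hproj, hφ, hsurj, hker⟩ := h.exists_projectiveCover hb
  obtain ⟨R, hR⟩ := hlin
  have hhom : ∀ j, ∀ x ∈ LinearMap.ker φ, gradedProj hQ.isInternal j x ∈ LinearMap.ker φ := by
    intro j x hx
    have h1 := IsGradedModule.map_proj_zero hQ h φ.toAddMonoidHom hφ j x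
    have h2 : φ.toAddMonoidHom x = 0 := hx
    rw [h2, map_zero] at h1
    exact h1.symm
  have hpow : ∀ k : ℕ, gradedJacobson 𝒜 ^ k • LinearMap.ker φ =
      LinearMap.ker φ ⊓ gradedJacobson 𝒜 ^ (k + 1) • (⊤ : Submodule A P) := by
    intro k
    refine le_antisymm (le_inf Submodule.smul_le_right
      (pow_smul_le_adicModule_succ _ hker k)) ?_
    -- Successive approximation: the remainder `z` stays in the kernel, so the one-step estimate
    -- applies to it again, and the new correction from `J^(k+m) Ker φ` lies in `J^k Ker φ`.
    have key : ∀ m : ℕ, LinearMap.ker φ ⊓ gradedJacobson 𝒜 ^ (k + 1) • (⊤ : Submodule A P) ≤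
        gradedJacobson 𝒜 ^ k • LinearMap.ker φ ⊔
          gradedJacobson 𝒜 ^ (k + 1 + m) • (⊤ : Submodule A P) := by
      intro m
      induction m with
      | zero => exact inf_le_right.trans le_sup_right
      | succ m ih =>
        intro x hx
        obtain ⟨y, hy, z, hz, rfl⟩ := Submodule.mem_sup.1 (ih hx)
        have hzK : z ∈ LinearMap.ker φ := by
          have := sub_mem hx.1 (Submodule.smul_le_right hy)
          rwa [add_sub_cancel_left] at this
        have hz' : z ∈ gradedJacobson 𝒜 ^ (k + m) • LinearMap.ker φ ⊔
            gradedJacobson 𝒜 ^ (k + m + 2) • (⊤ : Submodule A P) := by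
          refine ker_inf_pow_smul_le_of_isLinear _ R hR φ hsurj hker (k + m) ⟨hzK, ?_⟩
          rwa [show k + m + 1 = k + 1 + m by omega]
        rw [show k + m + 2 = k + 1 + (m + 1) by omega] at hz'
        have hle := ideal_pow_smul_le (gradedJacobson 𝒜) (Nat.le_add_right k m) (LinearMap.ker φ)
        exact add_mem (Submodule.mem_sup_left hy)
          ((sup_le_sup_right hle _ : _ ≤ (_ : Submodule A P)) hz')
    intro x hx
    -- `J^k Ker φ` is graded, hence closed, and absorbs the remainders.
    refine hQ.mem_of_forall_mem_sup hQb _ (hQ.proj_mem_pow_smul _ hhom k) fun m => ?_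
    have hle := ideal_pow_smul_le (gradedJacobson 𝒜) (Nat.le_add_left m (k + 1))
      (⊤ : Submodule A P)
    exact (sup_le_sup_left hle _ : _ ≤ (_ : Submodule A P)) (key m hx)
  refine ⟨⟨P, 𝒬, φ, hQ, hproj, hφ, hsurj, hpow, hQ.submodule _ hhom, ?_,
    exists_isLinear_ker _ R hR φ hsurj hpow⟩⟩
  obtain ⟨l, hl⟩ := hQb
  refine ⟨l, fun j hj => (AddSubgroup.eq_bot_iff_forall _).2 fun x hx => Subtype.ext ?_⟩
  have hx' : x.1 ∈ 𝒬 j := hx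
  rwa [hl j hj, AddSubgroup.mem_bot] at hx'

/-- The case `k = 0` says that `Ker d_n ⊆ J P_n`, and the kernel contains the image of the next
differential. -/
theorem GradedProjectiveResolution.isMinimal_of_pow_smul_ker (R : GradedProjectiveResolution 𝒜 ℳ)
    (hR : ∀ n k : ℕ, gradedJacobson 𝒜 ^ k • R.ker n =
      R.ker n ⊓ gradedJacobson 𝒜 ^ (k + 1) • (⊤ : Submodule A (R.P n))) : R.IsMinimal := by
  intro n
  have h1 : LinearMap.range (R.d n) ≤ R.ker n := by
    rintro _ ⟨x, rfl⟩
    cases n with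
    | zero => exact R.exact_zero.apply_apply_eq_zero x
    | succ n => exact (R.exact_succ n).apply_apply_eq_zero x
  have h2 := hR n 0
  rw [ideal_pow_zero_smul, zero_add, Submodule.pow_one] at h2
  exact h1.trans (h2.le.trans inf_le_right)

/-- A resolution of `M` from a cover of `M` and a resolution of the kernel. -/
def LinearCover.consResolution (C : LinearCover 𝒜 ℳ) (R : GradedProjectiveResolution 𝒜
      (submoduleGrading C.grading (LinearMap.ker C.φ))) : GradedProjectiveResolution 𝒜 ℳ where
  P
    | 0 => C.P
    | n + 1 => R.P n
  addCommGroup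
    | 0 => C.addCommGroup
    | n + 1 => R.addCommGroup n
  module
    | 0 => C.module
    | n + 1 => R.module n
  grading
    | 0 => C.grading
    | n + 1 => R.grading n
  isGraded
    | 0 => C.isGraded
    | n + 1 => R.isGraded n
  projective
    | 0 => C.projective
    | n + 1 => R.projective n
  ε := C.φ
  d
    | 0 => (LinearMap.ker C.φ).subtype.comp R.ε
    | n + 1 => R.d n
  ε_mem := C.φ_mem
  d_mem
    | 0 => R.ε_mem
    | n + 1 => R.d_mem n
  ε_surjective := C.φ_surjective
  exact_zero := fun x => by
    constructor
    · intro hx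
      obtain ⟨y, hy⟩ := R.ε_surjective ⟨x, hx⟩
      exact ⟨y, congrArg Subtype.val hy⟩
    · rintro ⟨y, rfl⟩
      exact (R.ε y).2
  exact_succ
    | 0 => fun x => by
      rw [← R.exact_zero x]
      exact Submodule.coe_eq_zero
    | n + 1 => R.exact_succ n

/-- The first cover is split off because `M` lives in universe `v` and its cover in `max u v`; all
further syzygies stay in `max u v`, where the recursion runs. -/
theorem LinearCover.isKoszul (C : LinearCover 𝒜 ℳ)
    (hK : IsKoszul 𝒜 (submoduleGrading C.grading (LinearMap.ker C.φ))) : IsKoszul 𝒜 ℳ := by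
  obtain ⟨R, -, hR⟩ := hK
  have h : ∀ n k : ℕ, gradedJacobson 𝒜 ^ k • (C.consResolution R).ker n =
      (C.consResolution R).ker n ⊓
        gradedJacobson 𝒜 ^ (k + 1) • (⊤ : Submodule A ((C.consResolution R).P n)) := by
    intro n k
    match n with
    | 0 => exact C.pow_smul_ker k
    | 1 =>
      have h1 : (C.consResolution R).ker 1 = R.ker 0 :=
        Submodule.ext fun x => Submodule.coe_eq_zero
      rw [h1]
      exact hR 0 k
    | n + 2 => exact hR (n + 1) k
  exact ⟨C.consResolution R, GradedProjectiveResolution.isMinimal_of_pow_smul_ker _ h, h⟩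

/-- Bounded below graded modules with a linear resolution of the associated graded module. -/
structure GrLinearModule (𝒜 : ℕ → AddSubgroup A) [GradedRing 𝒜] where
  carrier : Type w
  [addCommGroup : AddCommGroup carrier]
  [module : Module A carrier]
  grading : ℤ → AddSubgroup carrier
  isGraded : IsGradedModule 𝒜 grading
  isBoundedBelow : IsBoundedBelow grading
  hasLinearGrResolution : HasLinearGrResolution 𝒜 carrier

attribute [instance] GrLinearModule.addCommGroup GrLinearModule.module

/-- The kernel of a linear cover. -/
def LinearCover.syzygy (C : LinearCover 𝒜 ℳ) : GrLinearModule.{u, max u v} 𝒜 where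
  carrier := LinearMap.ker C.φ
  grading := submoduleGrading C.grading (LinearMap.ker C.φ)
  isGraded := C.isGraded_ker
  isBoundedBelow := C.isBoundedBelow_ker
  hasLinearGrResolution := C.hasLinearGrResolution_ker

/-! ### Iterated syzygies -/

namespace GrLinearModule

variable [IsArtinianRing (𝒜 0)] (D : GrLinearModule.{u, max u v} 𝒜)

/-- A choice of a linear cover. -/
def cover : LinearCover.{u, max u v} 𝒜 D.grading :=
  Classical.choice (nonempty_linearCover D.isGraded D.isBoundedBelow D.hasLinearGrResolution)

/-- The iterated syzygies. -/
def syzygies : ℕ → GrLinearModule.{u, max u v} 𝒜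
  | 0 => D
  | n + 1 => (syzygies n).cover.syzygy

/-- The resolution by iterated linear covers. -/
def resolution : GradedProjectiveResolution 𝒜 D.grading where
  P n := (D.syzygies n).cover.P
  grading n := (D.syzygies n).cover.grading
  isGraded n := (D.syzygies n).cover.isGraded
  projective n := (D.syzygies n).cover.projective
  ε := D.cover.φ
  d n := (LinearMap.ker (D.syzygies n).cover.φ).subtype.comp (D.syzygies (n + 1)).cover.φ
  ε_mem := D.cover.φ_mem
  d_mem n := (D.syzygies (n + 1)).cover.φ_mem
  ε_surjective := D.cover.φ_surjective
  exact_zero := fun x => by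
    constructor
    · intro hx
      obtain ⟨y, hy⟩ := (D.syzygies 1).cover.φ_surjective ⟨x, hx⟩
      exact ⟨y, congrArg Subtype.val hy⟩
    · rintro ⟨y, rfl⟩
      exact ((D.syzygies 1).cover.φ y).2
  exact_succ n := fun x => by
    constructor
    · intro hx
      have hx' : x ∈ LinearMap.ker (D.syzygies (n + 1)).cover.φ := Subtype.ext hx
      obtain ⟨y, hy⟩ := (D.syzygies (n + 2)).cover.φ_surjective ⟨x, hx'⟩
      exact ⟨y, congrArg Subtype.val hy⟩
    · rintro ⟨y, rfl⟩
      have h : (D.syzygies (n + 1)).cover.φ ((D.syzygies (n + 2)).cover.φ y).1 = 0 :=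
        ((D.syzygies (n + 2)).cover.φ y).2
      exact congrArg Subtype.val h

theorem isKoszul : IsKoszul 𝒜 D.grading := by
  have h : ∀ n k : ℕ, gradedJacobson 𝒜 ^ k • D.resolution.ker n =
      D.resolution.ker n ⊓
        gradedJacobson 𝒜 ^ (k + 1) • (⊤ : Submodule A (D.resolution.P n)) := by
    intro n k
    have hker : D.resolution.ker n = LinearMap.ker (D.syzygies n).cover.φ := by
      cases n with
      | zero => rfl
      | succ n => exact Submodule.ext fun x => Submodule.coe_eq_zero
    rw [hker]
    exact (D.syzygies n).cover.pow_smul_ker k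
  exact ⟨D.resolution, GradedProjectiveResolution.isMinimal_of_pow_smul_ker _ h, h⟩

end GrLinearModule

theorem isKoszul_of_hasLinearGrResolution [IsArtinianRing (𝒜 0)] (h : IsGradedModule 𝒜 ℳ)
    (hb : IsBoundedBelow ℳ) (hlin : HasLinearGrResolution 𝒜 M) : IsKoszul 𝒜 ℳ := by
  obtain ⟨C⟩ := nonempty_linearCover h hb hlin
  exact C.isKoszul (GrLinearModule.isKoszul.{u, v} C.syzygy)

end MinimalResolution

/-! ### The associated graded module of `A / J` -/

section QuotientModule

variable {A : Type u} [Ring A]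

/-- Since `A_{≥1} ⊆ J`, the quotient is concentrated in degree 0. -/
theorem isGradedModule_quotient_gradedJacobson (𝒜 : ℕ → AddSubgroup A) [GradedRing 𝒜] :
    IsGradedModule 𝒜 (quotientGrading 𝒜 (gradedJacobson 𝒜)) := by
  have hpos : ∀ n ≠ 0, ∀ a ∈ 𝒜 n, Submodule.mkQ (gradedJacobson 𝒜) a = 0 := fun n hn a ha =>
    (Submodule.Quotient.mk_eq_zero _).2
      (positivePart_le_gradedJacobson (mem_positivePart_of_mem hn ha))
  refine .extendByZero (isInternal_of_projections
    (fun n => if n = 0 then AddMonoidHom.id _ else 0) ?_ ?_ ?_) ?_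
  · rintro n _ ⟨a, ha, rfl⟩
    split_ifs with hn
    · rfl
    · exact (hpos n hn a ha).symm
  · rintro m n hmn _ ⟨a, ha, rfl⟩
    split_ifs with hn
    · exact hpos m (fun h => hmn (h.trans hn.symm)) a ha
    · rfl
  · intro x
    obtain ⟨a, rfl⟩ := Submodule.mkQ_surjective _ x
    refine AddSubgroup.mem_iSup_of_mem 0 ⟨DirectSum.decompose 𝒜 a 0, SetLike.coe_mem _, ?_⟩
    refine (Submodule.Quotient.eq _).2 (positivePart_le_gradedJacobson ?_)
    rw [mem_positivePart_iff, DirectSum.decompose_sub, DirectSum.decompose_coe]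
    simp
  · rintro i j a ha _ ⟨b, hb, rfl⟩
    exact ⟨a * b, SetLike.GradedMul.mul_mem ha hb, rfl⟩

variable (I : Ideal A) [I.IsTwoSided]

theorem adicModule_quotient_eq_bot {n : ℕ} (hn : n ≠ 0) : adicModule (A ⧸ I) I n = ⊥ := by
  obtain ⟨m, rfl⟩ := Nat.exists_eq_succ_of_ne_zero hn
  refine le_bot_iff.1 ((ideal_pow_smul_le I (Nat.le_add_left 1 m) _).trans ?_)
  rw [Submodule.pow_one]
  refine Submodule.smul_le.2 fun a ha x _ => ?_
  obtain ⟨b, rfl⟩ := Submodule.mkQ_surjective _ x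
  rw [← map_smul, Submodule.mem_bot]
  exact (Submodule.Quotient.mk_eq_zero _).2 (I.mul_mem_right b ha)

theorem grMk_quotient_eq_zero {n : ℕ} (hn : n ≠ 0) (x : adicModule (A ⧸ I) I n) :
    grMk I n x = 0 := by
  have hx : x = 0 :=
    Subtype.ext ((Submodule.mem_bot A).1 ((adicModule_quotient_eq_bot I hn).le x.2))
  rw [hx, map_zero]

/-- The class of `1` in `Gr_I (A / I)`. -/
def grQuotientOne : GrModule (A ⧸ I) I :=
  grMk I 0 ⟨Submodule.mkQ I 1, mem_adicModule_zero I _⟩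

theorem grRingMk_smul_grQuotientOne (n : ℕ) (a : adicRing I n) :
    grRingMk I n a • grQuotientOne I = grMk I n ⟨a.1 • Submodule.mkQ I 1,
      adicModule_smul_mem I n 0 _ _ a.2 (mem_adicModule_zero I _)⟩ :=
  grRingMk_smul_grMk I _ _

/-- `I` annihilates `A/I`, so `Gr_I (A/I)` is concentrated in degree 0 and components of positive
degree act on the class of `1` as zero. -/
theorem smul_grQuotientOne (b : Gr I) : b • grQuotientOne I =
    (DirectSum.decompose (grGrading I) b 0 : Gr I) • grQuotientOne I := by
  induction b using DirectSum.Decomposition.inductionOn (grGrading I) with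
  | zero => simp
  | @homogeneous n b =>
    by_cases hn : n = 0
    · subst hn
      rw [DirectSum.decompose_of_mem_same _ b.2]
    · rw [DirectSum.decompose_of_mem_ne _ b.2 hn, zero_smul]
      obtain ⟨a, ha⟩ := (mem_grGrading_iff I).1 b.2
      rw [← ha, grRingMk_smul_grQuotientOne, grMk_quotient_eq_zero I hn]
  | add b c hb hc => rw [add_smul, hb, hc, DirectSum.decompose_add, ← add_smul]; rfl

theorem grRingMk_eq_zero {n : ℕ} {a : adicRing I n} (ha : a.1 ∈ adicRing I (n + 1)) :
    grRingMk I n a = 0 := by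
  have h1 : GrPiece.mk (adicRing I) n a = 0 := (Submodule.Quotient.mk_eq_zero _).2 ha
  rw [grRingMk, AddMonoidHom.comp_apply, h1, map_zero]

theorem smul_grQuotientOne_eq_zero_iff (b : Gr I) :
    b • grQuotientOne I = 0 ↔ b ∈ positivePart (grGrading I) := by
  rw [mem_positivePart_iff, smul_grQuotientOne]
  refine ⟨fun h => ?_, fun h => by rw [h, zero_smul]⟩
  obtain ⟨a, ha⟩ := (mem_grGrading_iff I).1
    (SetLike.coe_mem (DirectSum.decompose (grGrading I) b 0))
  rw [← ha] at h ⊢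
  rw [grRingMk_smul_grQuotientOne, grMk_eq_zero_iff, adicModule_quotient_eq_bot I (Nat.succ_ne_zero 0),
    Submodule.mem_bot] at h
  change a.1 • Submodule.mkQ I 1 = 0 at h
  rw [← map_smul, smul_eq_mul, mul_one] at h
  refine grRingMk_eq_zero I ?_
  change a.1 ∈ I ^ 1
  rw [Submodule.pow_one]
  exact (Submodule.Quotient.mk_eq_zero _).1 h

/-- `Gr_I (A/I)` is cyclic, generated by the class of `1`, with annihilator the positive part of
`Gr_I A`. This reduces the statement on rings to the one on modules. -/
theorem exists_bijective_quotient_positivePart :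
    ∃ θ : (Gr I ⧸ positivePart (grGrading I)) →ₗ[Gr I] GrModule (A ⧸ I) I,
      Function.Bijective θ ∧ ∀ j, ∀ x ∈ quotientGrading (grGrading I) (positivePart (grGrading I)) j,
        θ x ∈ grModuleGrading (A ⧸ I) I j := by
  let τ : Gr I →ₗ[Gr I] GrModule (A ⧸ I) I := LinearMap.toSpanSingleton _ _ (grQuotientOne I)
  have hτ : ∀ b, τ b = b • grQuotientOne I := fun _ => rfl
  have hker : LinearMap.ker τ = positivePart (grGrading I) :=
    Submodule.ext fun b => smul_grQuotientOne_eq_zero_iff I b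
  refine ⟨Submodule.liftQ _ τ hker.ge, ⟨?_, ?_⟩, ?_⟩
  · rw [← LinearMap.ker_eq_bot]
    exact Submodule.ker_liftQ_eq_bot _ _ _ hker.le
  · rw [← LinearMap.range_eq_top, Submodule.range_liftQ, LinearMap.range_eq_top]
    intro y
    induction y using grModule_induction with
    | mk n x =>
      by_cases hn : n = 0
      · subst hn
        obtain ⟨x, hx⟩ := x
        obtain ⟨a, rfl⟩ := Submodule.mkQ_surjective _ x
        refine ⟨grRingMk I 0 ⟨a, ?_⟩, ?_⟩
        · change a ∈ I ^ 0
          rw [Submodule.pow_zero, Ideal.one_eq_top]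
          trivial
        · rw [hτ, grRingMk_smul_grQuotientOne]
          refine grMk_congr I rfl _ _ ?_
          change a • Submodule.mkQ I 1 = Submodule.mkQ I a
          rw [← map_smul, smul_eq_mul, mul_one]
      · exact ⟨0, by rw [map_zero, grMk_quotient_eq_zero I hn]⟩
    | add y z hy hz =>
      obtain ⟨b, rfl⟩ := hy
      obtain ⟨c, rfl⟩ := hz
      exact ⟨b + c, map_add _ _ _⟩
  · rintro (n | n) x hx
    · obtain ⟨b, hb, rfl⟩ := hx
      exact (isGradedModule_grModule I (A ⧸ I)).smul_mem n 0 b hb _ (grMk_mem I 0 _)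
    · rw [AddSubgroup.mem_bot.1 hx, map_zero]
      exact zero_mem _

/-- Only the augmentation changes: it is composed with the isomorphism `θ`. -/
theorem exists_isLinear_of_bijective {B : Type u} [Ring B] {ℬ : ℕ → AddSubgroup B}
    {M N : Type v} [AddCommGroup M] [Module B M] [AddCommGroup N] [Module B N]
    {ℳ : ℤ → AddSubgroup M} {𝒩 : ℤ → AddSubgroup N} (θ : M →ₗ[B] N) (hθ : Function.Bijective θ)
    (hdeg : ∀ j, ∀ x ∈ ℳ j, θ x ∈ 𝒩 j) (R : GradedProjectiveResolution ℬ ℳ) (hR : R.IsLinear) :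
    ∃ R' : GradedProjectiveResolution ℬ 𝒩, R'.IsLinear := by
  refine ⟨{ R with
            ε := θ.comp R.ε
            ε_mem := fun j x hx => hdeg j _ (R.ε_mem j x hx)
            ε_surjective := hθ.2.comp R.ε_surjective
            exact_zero := fun x => ?_ }, hR⟩
  rw [← R.exact_zero x]
  exact map_eq_zero_iff θ hθ.1

end QuotientModule

end GradedKoszul

end

theorem theorem5 {A : Type u} [Ring A] (𝒜 : ℕ → AddSubgroup A) [GradedRing 𝒜]
    (hfin : GradedKoszul.IsLeftFinite 𝒜 𝒜) (hgen : GradedKoszul.IsGeneratedInDegreeOne 𝒜)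
    (hart : IsArtinianRing (𝒜 0)) :
    (∀ (M : Type v) [AddCommGroup M] [Module A M] (ℳ : ℤ → AddSubgroup M),
      GradedKoszul.IsGradedModule 𝒜 ℳ →
      GradedKoszul.IsLeftFinite 𝒜 ℳ →
      GradedKoszul.IsBoundedBelow ℳ →
      GradedKoszul.IsClassicallyKoszul
        (GradedKoszul.grGrading (GradedKoszul.gradedJacobson 𝒜))
        (GradedKoszul.grModuleGrading M (GradedKoszul.gradedJacobson 𝒜)) →
      GradedKoszul.IsKoszul 𝒜 ℳ) ∧
    (GradedKoszul.IsClassicallyKoszulRing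
        (GradedKoszul.grGrading (GradedKoszul.gradedJacobson 𝒜)) →
      GradedKoszul.IsKoszulRing 𝒜) := by
  constructor
  · rintro M _ _ ℳ hℳ - hb ⟨-, -, hlin⟩
    exact GradedKoszul.isKoszul_of_hasLinearGrResolution hℳ hb hlin
  · rintro ⟨-, -, R, hR⟩
    obtain ⟨θ, hθ, hdeg⟩ :=
      GradedKoszul.exists_bijective_quotient_positivePart (GradedKoszul.gradedJacobson 𝒜)
    -- The module argument is applied to `A/J`, bounded below by degree 0, with the linear
    -- resolution transported along `θ`.
    exact GradedKoszul.isKoszul_of_hasLinearGrResolution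
      (GradedKoszul.isGradedModule_quotient_gradedJacobson 𝒜)
      ⟨0, fun j hj => GradedKoszul.extendByZero_of_neg _ hj⟩
      (GradedKoszul.exists_isLinear_of_bijective θ hθ hdeg R hR)
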